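/- Let $d \ge 2$, let $\mathbb B$ and $\mathbb S$ be the open unit ball and the unit sphere of $\mathbb R^d$, and let $V$ denote volume in $\mathbb R^d$. Let $R : \mathbb S \to (0,\infty)$ be Lipschitz continuous and let $\Omega = \{ r\xi : \xi \in \mathbb S,\ 0 \le r < R(\xi) \}$. Then there is a homeomorphism $H : \mathbb S \to \mathbb S$, with $H$ and $H^{-1}$ Lipschitz, whose (signed) Jacobian determinant satisfies $$\operatorname{Jac}_H(\xi) = \frac{V(\mathbb B)}{V(\Omega)}\, R(\xi)^d \qquad \text{for almost every } \xi \in \mathbb S ,$$ so that the surface area of $H(A)$ equals $\frac{V(\mathbb B)}{V(\Omega)} \int_A R^d \, dS$ for every Borel set $A \subset \mathbb S$. Moreover the map $$T : \Omega \to \mathbb B, \qquad T(r\xi) = \frac{r}{R(\xi)} H(\xi) \qquad (\xi \in \mathbb S,\ 0 \le r < R(\xi)),$$ which is linear on each ray from the origin, is a homeomorphism of $\Omega$ onto $\mathbb B$, with $T$ and $T^{-1}$ Lipschitz, and has constant Jacobian determinant: $\operatorname{Jac}(T) = V(\mathbb B)/V(\Omega)$ almost everywhere in $\Omega$ and $\operatorname{Jac}(T^{-1})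 = V(\Omega)/V(\mathbb B)$ almost everywhere in $\mathbb B$. -/

import Mathlib

open MeasureTheory Metric

noncomputable section

/-- Euclidean space `ℝ^d`. -/
abbrev Euc (d : ℕ) : Type := EuclideanSpace ℝ (Fin d)

/-- The unit sphere `𝕊^{d-1}` in `ℝ^d`. -/
abbrev USphere (d : ℕ) : Type := sphere (0 : Euc d) 1

/-- Surface area measure on the unit sphere: the measure of `A` is `d` times the volume of the
cone `{r ξ : 0 < r < 1, ξ ∈ A}`. -/
abbrev surfaceMeasure (d : ℕ) : Measure (USphere d) := (volume : Measure (Euc d)).toSphere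

/-- The starlike set `{r ξ : ξ ∈ 𝕊, 0 ≤ r < R ξ}` with radius function `R`. -/
def starlikeDomain {d : ℕ} (R : USphere d → ℝ) : Set (Euc d) :=
  {x | ∃ (ξ : USphere d) (r : ℝ), 0 ≤ r ∧ r < R ξ ∧ x = r • (ξ : Euc d)}

/-- The volume ratio `V(𝔹) / V(Ω)`, where `Ω` has radius function `R`. -/
def volumeRatio {d : ℕ} (R : USphere d → ℝ) : ℝ :=
  volume.real (ball (0 : Euc d) 1) / volume.real (starlikeDomain R)

/-- The direction `x / |x|` of a nonzero vector. -/
def direction {d : ℕ} (x : Euc d) (hx : x ≠ 0) : USphere d :=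
  ⟨‖x‖⁻¹ • x, by
    rw [mem_sphere_zero_iff_norm, norm_smul, norm_inv, norm_norm,
      inv_mul_cancel₀ (norm_ne_zero_iff.2 hx)]⟩

open scoped Classical in
/-- The extension of a map of the sphere to the nonzero vectors, homogeneous of degree `0`:
`H (r ξ) = H ξ` for `r > 0`. (The value at the origin is irrelevant.) -/
def homogeneousExtension {d : ℕ} (H : USphere d → USphere d) (x : Euc d) : Euc d :=
  if hx : x = 0 then 0 else (H (direction x hx) : Euc d)

/-- `H` is differentiable at `ξ` and its (signed) Jacobian determinant there, as a map of the
sphere, is `J`.  The derivative `D` of the homogeneous extension kills `ξ`, and on the tangent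
space `ξ^⊥` it is the tangent map `ξ^⊥ → (H ξ)^⊥`.  The Jacobian is the determinant of this tangent
map with respect to orthonormal bases that are positively oriented for the outward normals `ξ` and
`H ξ`; this is the determinant on `ℝ^d` of `D + (H ξ) ξᵀ`, the map which agrees with the tangent
map on `ξ^⊥` and sends the normal `ξ` to the normal `H ξ`. -/
def HasSphereJacobianAt {d : ℕ} (H : USphere d → USphere d) (ξ : USphere d) (J : ℝ) : Prop :=
  ∃ D : Euc d →L[ℝ] Euc d, HasFDerivAt (homogeneousExtension H) D (ξ : Euc d) ∧
    (D + (innerSL ℝ (ξ : Euc d)).smulRight (H ξ : Euc d)).det = J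

/-- `f` is differentiable at `x`, with Jacobian determinant `J`. -/
def HasJacobianAt {d : ℕ} (f : Euc d → Euc d) (x : Euc d) (J : ℝ) : Prop :=
  DifferentiableAt ℝ f x ∧ (fderiv ℝ f x).det = J

end

/-! Encode Ω by its gauge ρ, the degree-one function with ρ < 1 exactly on Ω. It suffices to find a
homogeneous bi-Lipschitz bijection T of ℝ^d with constant Jacobian k > 0 and |T x| = ρ x: it maps Ω
onto 𝔹, volumes force k = V(𝔹)/V(Ω), and H ξ = R(ξ) T ξ. In fact any two gauges are linked by such a
map (`allGaugesEquiv_euc`).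

Rescaling along rays by a degree-zero factor c has Jacobian c^d, so it is enough to transport the
density ρ^(-d) to σ^(-d), up to a constant, by a homogeneous bi-Lipschitz map
(`GaugeEquiv.of_density`). On E × ℝ with n = dim E this is done line by line. Integrating ρ^(-(n+1))
over vertical lines gives f^(-n)/n for a gauge f on E (`IsGauge.isGauge_fiberRadius`); induction
supplies a map S of E matching these marginals, and the mass on each line is then matched
monotonically.

To stay Lipschitz and homogeneous, the upper and lower tail masses are recorded as lengths U, L = (n
· mass)^(-1/n). The height v = U - L is Lipschitz of degree one, and ∂v/∂t = (U^(n+1) + L^(n+1)) /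
ρ^(n+1) is bounded below, so (y, t) ↦ (y, v) is bi-Lipschitz. Since U^(-n) + L^(-n) = f^(-n) on each
line, v determines U and L. Conjugating S × id by the two height maps therefore matches both
lengths, and its Jacobian is k (ρ'/ρ)^(n+1) (`GaugeEquiv.of_fiberRadius`).

The induction starts in the plane: on the line, homogeneous maps of constant positive Jacobian are
linear, so the fiber gauges must first be made even, by a rotation found with the intermediate value
theorem. -/

noncomputable section

open Set Filter Topology
open scoped NNReal ENNReal Pointwise

set_option linter.unusedSectionVars false

/-! ### Gauges and homogeneous bi-Lipschitz maps -/

section Homogeneous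

variable {E : Type*} [NormedAddCommGroup E] [NormedSpace ℝ E]

/-- A Lipschitz function, positively homogeneous of degree one and positive away from the
origin. -/
structure IsGauge (ρ : E → ℝ) : Prop where
  lip : ∃ K, LipschitzWith K ρ
  pos : ∀ x, x ≠ 0 → 0 < ρ x
  smul : ∀ r : ℝ, 0 ≤ r → ∀ x, ρ (r • x) = r * ρ x

/-- A bi-Lipschitz bijection, positively homogeneous of degree one. -/
structure HomogBiLip (E : Type*) [NormedAddCommGroup E] [NormedSpace ℝ E] extends E ≃ E where
  lip : ∃ K, LipschitzWith K toFun
  lip_symm : ∃ K, LipschitzWith K invFun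
  map_smul' : ∀ r : ℝ, 0 ≤ r → ∀ x, toFun (r • x) = r • toFun x

namespace HomogBiLip

instance : CoeFun (HomogBiLip E) fun _ => E → E := ⟨fun T => T.toEquiv⟩

theorem lipschitz (T : HomogBiLip E) : ∃ K, LipschitzWith K T := T.lip

theorem map_smul (T : HomogBiLip E) {r : ℝ} (hr : 0 ≤ r) (x : E) : T (r • x) = r • T x :=
  T.map_smul' r hr x

theorem map_zero (T : HomogBiLip E) : T 0 = 0 := by
  simpa using T.map_smul le_rfl (0 : E)

/-- The inverse of a homogeneous bi-Lipschitz bijection. -/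
def symm (T : HomogBiLip E) : HomogBiLip E where
  toEquiv := T.toEquiv.symm
  lip := T.lip_symm
  lip_symm := T.lip
  map_smul' r hr x := by
    change T.toEquiv.symm (r • x) = r • T.toEquiv.symm x
    rw [Equiv.symm_apply_eq, T.map_smul hr, Equiv.apply_symm_apply]

@[simp] theorem symm_apply_apply (T : HomogBiLip E) (x : E) : T.symm (T x) = x :=
  T.toEquiv.symm_apply_apply x

@[simp] theorem apply_symm_apply (T : HomogBiLip E) (x : E) : T (T.symm x) = x :=
  T.toEquiv.apply_symm_apply x

theorem injective (T : HomogBiLip E) : Function.Injective T := T.toEquiv.injective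

theorem map_eq_zero (T : HomogBiLip E) {x : E} : T x = 0 ↔ x = 0 :=
  ⟨fun h => T.injective (h.trans T.map_zero.symm), fun h => h ▸ T.map_zero⟩

/-- Composition: first `T`, then `S`. -/
def trans (T S : HomogBiLip E) : HomogBiLip E where
  toEquiv := T.toEquiv.trans S.toEquiv
  lip := by
    obtain ⟨K, hK⟩ := T.lip
    obtain ⟨L, hL⟩ := S.lip
    exact ⟨L * K, hL.comp hK⟩
  lip_symm := by
    obtain ⟨K, hK⟩ := T.lip_symm
    obtain ⟨L, hL⟩ := S.lip_symm
    exact ⟨K * L, hK.comp hL⟩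
  map_smul' r hr x := by
    change S (T (r • x)) = r • S (T x)
    rw [T.map_smul hr, S.map_smul hr]

@[simp] theorem trans_apply (T S : HomogBiLip E) (x : E) : (T.trans S) x = S (T x) := rfl

theorem continuous (T : HomogBiLip E) : Continuous T := T.lip.choose_spec.continuous

/-- The underlying homeomorphism. -/
def toHomeomorph (T : HomogBiLip E) : E ≃ₜ E where
  toEquiv := T.toEquiv
  continuous_toFun := T.continuous
  continuous_invFun := T.symm.continuous

/-- An invertible linear map as a homogeneous bi-Lipschitz bijection. -/
def ofLinear (L : E ≃L[ℝ] E) : HomogBiLip E where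
  toEquiv := L.toEquiv
  lip := ⟨_, L.lipschitz⟩
  lip_symm := ⟨_, L.symm.lipschitz⟩
  map_smul' r _ x := L.map_smul r x

end HomogBiLip

namespace IsGauge

theorem map_zero {ρ : E → ℝ} (h : IsGauge ρ) : ρ 0 = 0 := by
  simpa using h.smul 0 le_rfl (0 : E)

theorem nonneg {ρ : E → ℝ} (h : IsGauge ρ) (x : E) : 0 ≤ ρ x := by
  by_cases hx : x = 0
  · rw [hx, h.map_zero]
  · exact (h.pos x hx).le

theorem continuous {ρ : E → ℝ} (h : IsGauge ρ) : Continuous ρ := h.lip.choose_spec.continuous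

theorem comp {ρ : E → ℝ} (h : IsGauge ρ) (T : HomogBiLip E) : IsGauge (fun x => ρ (T x)) where
  lip := by
    obtain ⟨K, hK⟩ := T.lip
    obtain ⟨L, hL⟩ := h.lip
    exact ⟨L * K, hL.comp hK⟩
  pos x hx := h.pos _ (fun h0 => hx (T.map_eq_zero.1 h0))
  smul r hr x := by rw [T.map_smul hr, h.smul r hr]

theorem comp_linear {F : Type*} [NormedAddCommGroup F] [NormedSpace ℝ F] {ρ : F → ℝ}
    (h : IsGauge ρ) (L : E ≃L[ℝ] F) : IsGauge (fun x => ρ (L x)) where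
  lip := by
    obtain ⟨K, hK⟩ := h.lip
    exact ⟨_, hK.comp L.lipschitz⟩
  pos x hx := h.pos _ (by simpa using hx)
  smul r hr x := by rw [L.map_smul, h.smul r hr]

theorem norm : IsGauge (fun x : E => ‖x‖) where
  lip := ⟨1, lipschitzWith_one_norm⟩
  pos x hx := norm_pos_iff.2 hx
  smul r hr x := by rw [norm_smul, Real.norm_of_nonneg hr]

theorem exists_le {ρ : E → ℝ} (h : IsGauge ρ) : ∃ C, 0 < C ∧ ∀ x, ρ x ≤ C * ‖x‖ := by
  obtain ⟨K, hK⟩ := h.lip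
  refine ⟨K + 1, by positivity, fun x => ?_⟩
  have := hK.dist_le_mul x 0
  rw [h.map_zero, Real.dist_eq, sub_zero, dist_zero_right, abs_of_nonneg (h.nonneg x)] at this
  nlinarith [norm_nonneg x]

theorem exists_ge [FiniteDimensional ℝ E] {ρ : E → ℝ} (h : IsGauge ρ) :
    ∃ c, 0 < c ∧ ∀ x, c * ‖x‖ ≤ ρ x := by
  rcases subsingleton_or_nontrivial E with hE | hE
  · exact ⟨1, one_pos, fun x => by simp [Subsingleton.elim x 0, h.map_zero]⟩
  obtain ⟨z, hz, hmin⟩ := (isCompact_sphere (0 : E) 1).exists_isMinOn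
    (NormedSpace.sphere_nonempty.2 zero_le_one) h.continuous.continuousOn
  have hz1 : ‖z‖ = 1 := by simpa using hz
  refine ⟨ρ z, h.pos z (by rintro rfl; simp at hz1), fun x => ?_⟩
  by_cases hx : x = 0
  · simp [hx, h.map_zero]
  have hx0 : 0 < ‖x‖ := norm_pos_iff.2 hx
  have hmem : ‖x‖⁻¹ • x ∈ sphere (0 : E) 1 := by
    simp [norm_smul, hx0.ne']
  have h1 : ρ z ≤ ρ (‖x‖⁻¹ • x) := hmin hmem
  rw [h.smul _ (by positivity), inv_mul_eq_div, le_div_iff₀ hx0] at h1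
  exact h1

end IsGauge

/-- Rescaling along rays by a quotient of gauges is Lipschitz. -/
theorem IsGauge.lipschitz_radial [FiniteDimensional ℝ E] {a b : E → ℝ} (ha : IsGauge a)
    (hb : IsGauge b) : ∃ K, LipschitzWith K (fun x : E => (a x / b x) • x) := by
  obtain ⟨K, hK⟩ := ha.lip
  obtain ⟨L, hL⟩ := hb.lip
  obtain ⟨A, hA, hAle⟩ := ha.exists_le
  obtain ⟨B, hB, hBle⟩ := hb.exists_le
  obtain ⟨c, hc, hcle⟩ := hb.exists_ge
  set M : ℝ := A / c + (A * L + B * K) / (c * c) with hM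
  have hM0 : 0 ≤ M := by positivity
  have hratio : ∀ x, a x / b x ≤ A / c := fun x => by
    by_cases hx : x = 0
    · rw [hx, hb.map_zero, div_zero]; positivity
    rw [div_le_div_iff₀ (hb.pos x hx) hc]
    nlinarith [mul_le_mul_of_nonneg_left (hcle x) hA.le, mul_le_mul_of_nonneg_right (hAle x) hc.le]
  have hr0 : ∀ x, 0 ≤ a x / b x := fun x => div_nonneg (ha.nonneg x) (hb.nonneg x)
  refine ⟨M.toNNReal, LipschitzWith.of_dist_le_mul fun x y => ?_⟩
  rw [Real.coe_toNNReal _ hM0, dist_eq_norm, dist_eq_norm]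
  -- The ratio has degree zero, so it varies by O(‖x - y‖ / ‖y‖); the weight ‖y‖ in the second term
  -- absorbs the singularity at the origin.
  have hdec : (a x / b x) • x - (a y / b y) • y
      = (a x / b x) • (x - y) + (a x / b x - a y / b y) • y := by
    rw [smul_sub, sub_smul]; abel
  rw [hdec]
  refine (norm_add_le _ _).trans ?_
  rw [norm_smul, norm_smul, Real.norm_of_nonneg (hr0 x)]
  have h1 : a x / b x * ‖x - y‖ ≤ A / c * ‖x - y‖ :=
    mul_le_mul_of_nonneg_right (hratio x) (norm_nonneg _)
  have h2 : ‖a x / b x - a y / b y‖ * ‖y‖ ≤ (A * L + B * K) / (c * c) * ‖x - y‖ := by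
    by_cases hy : y = 0
    · rw [hy, norm_zero, mul_zero]; positivity
    -- Here `a x / b x` is `0 / 0 = 0`, so the difference is the whole ratio at y, at most K / c;
    -- the inequality c ≤ B fits this under the general constant.
    by_cases hx : x = 0
    · have hyn : 0 < ‖y‖ := norm_pos_iff.2 hy
      have hay : a y ≤ K * ‖y‖ := by
        have := hK.dist_le_mul y 0
        rwa [ha.map_zero, Real.dist_eq, sub_zero, dist_zero_right,
          abs_of_nonneg (ha.nonneg y)] at this
      have hby := hb.pos y hy
      have hcB : c ≤ B := by
        have := (hcle y).trans (hBle y)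
        exact le_of_mul_le_mul_right this hyn
      rw [hx, hb.map_zero, div_zero, zero_sub, zero_sub, norm_neg, norm_neg,
        Real.norm_of_nonneg (hr0 y)]
      refine mul_le_mul_of_nonneg_right ?_ (norm_nonneg _)
      rw [div_le_div_iff₀ hby (by positivity)]
      have e1 : a y * (c * c) ≤ K * ‖y‖ * (c * B) := by gcongr
      have e2 : B * K * (c * ‖y‖) ≤ (A * L + B * K) * b y := by
        gcongr
        · nlinarith [mul_nonneg hA.le L.2]
        · exact hcle y
      nlinarith
    have hxn : 0 < ‖x‖ := norm_pos_iff.2 hx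
    have hyn : 0 < ‖y‖ := norm_pos_iff.2 hy
    have hbx := hb.pos x hx
    have hby := hb.pos y hy
    have hL' : |b y - b x| ≤ L * ‖x - y‖ := by
      have := hL.dist_le_mul y x
      rwa [Real.dist_eq, dist_eq_norm, norm_sub_rev] at this
    have hK' : |a x - a y| ≤ K * ‖x - y‖ := by
      have := hK.dist_le_mul x y
      rwa [Real.dist_eq, dist_eq_norm] at this
    have e : a x / b x - a y / b y = (a x * (b y - b x) + b x * (a x - a y)) / (b x * b y) := by
      field_simp; ring
    rw [e, Real.norm_eq_abs, abs_div, abs_of_pos (mul_pos hbx hby)]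
    have hnum : |a x * (b y - b x) + b x * (a x - a y)| ≤ (A * L + B * K) * ‖x‖ * ‖x - y‖ := by
      calc _ ≤ |a x * (b y - b x)| + |b x * (a x - a y)| := abs_add_le _ _
        _ = a x * |b y - b x| + b x * |a x - a y| := by
          rw [abs_mul, abs_mul, abs_of_nonneg (ha.nonneg x), abs_of_pos hbx]
        _ ≤ (A * ‖x‖) * (L * ‖x - y‖) + (B * ‖x‖) * (K * ‖x - y‖) := by
          have := hAle x
          have := hBle x
          gcongr
        _ = _ := by ring
    rw [div_mul_eq_mul_div, div_mul_eq_mul_div, div_le_div_iff₀ (mul_pos hbx hby) (by positivity)]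
    have hden : (c * ‖x‖) * (c * ‖y‖) ≤ b x * b y := by
      have := hcle x
      have := hcle y
      gcongr
    calc _ ≤ ((A * L + B * K) * ‖x‖ * ‖x - y‖) * ‖y‖ * (c * c) := by gcongr
      _ = (A * L + B * K) * ‖x - y‖ * ((c * ‖x‖) * (c * ‖y‖)) := by ring
      _ ≤ _ := by gcongr
  calc _ ≤ A / c * ‖x - y‖ + (A * L + B * K) / (c * c) * ‖x - y‖ := add_le_add h1 h2
    _ = M * ‖x - y‖ := by rw [hM]; ring

namespace HomogBiLip

/-- The map `x ↦ (a x / b x) x` which carries the gauge `a` to the gauge `b` along rays. -/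
def radial [FiniteDimensional ℝ E] {a b : E → ℝ} (ha : IsGauge a) (hb : IsGauge b) :
    HomogBiLip E where
  toFun x := (a x / b x) • x
  invFun x := (b x / a x) • x
  left_inv x := by
    by_cases hx : x = 0
    · simp [hx]
    have h1 := ha.pos x hx
    have h2 := hb.pos x hx
    simp only
    rw [ha.smul _ (by positivity), hb.smul _ (by positivity), smul_smul]
    convert one_smul ℝ x
    field_simp
  right_inv x := by
    by_cases hx : x = 0
    · simp [hx]
    have h1 := ha.pos x hx
    have h2 := hb.pos x hx
    simp only
    rw [ha.smul _ (by positivity), hb.smul _ (by positivity), smul_smul]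
    convert one_smul ℝ x
    field_simp
  lip := ha.lipschitz_radial hb
  lip_symm := hb.lipschitz_radial ha
  map_smul' r hr x := by
    rcases hr.eq_or_lt with rfl | hr'
    · simp
    · rw [ha.smul r hr, hb.smul r hr, mul_div_mul_left _ _ hr'.ne', smul_comm]

theorem radial_apply [FiniteDimensional ℝ E] {a b : E → ℝ} (ha : IsGauge a) (hb : IsGauge b)
    (x : E) : radial ha hb x = (a x / b x) • x := rfl

end HomogBiLip

end Homogeneous

/-! ### Almost everywhere Jacobians and equivalence of gauges -/

section Jacobian

variable {E : Type*} [NormedAddCommGroup E] [NormedSpace ℝ E] [FiniteDimensional ℝ E]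
  [MeasureSpace E] [BorelSpace E] [(volume : Measure E).IsAddHaarMeasure]

/-- `T` is differentiable almost everywhere, with Jacobian determinant `f`. -/
def HasDet (T : E → E) (f : E → ℝ) : Prop :=
  ∀ᵐ x, ∃ D : E →L[ℝ] E, HasFDerivAt T D x ∧ D.det = f x

/-- Hausdorff measure of the full dimension has the same null sets as volume, and a Lipschitz map
enlarges it by at most a constant factor. -/
theorem LipschitzWith.volume_image_eq_zero {K : ℝ≥0} {f : E → E} (hf : LipschitzWith K f)
    {s : Set E} (hs : volume s = 0) : volume (f '' s) = 0 := by
  have h1 : (Measure.hausdorffMeasure (Module.finrank ℝ E) : Measure E) s = 0 :=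
    Measure.absolutelyContinuous_isAddHaarMeasure _ volume hs
  have h2 := hf.hausdorffMeasure_image_le (d := Module.finrank ℝ E) (by positivity) s
  rw [h1, mul_zero, nonpos_iff_eq_zero] at h2
  exact Measure.absolutelyContinuous_isAddHaarMeasure volume
    (Measure.hausdorffMeasure (Module.finrank ℝ E)) h2

namespace HomogBiLip

/-- A preimage is an image under the Lipschitz inverse. This is what lets almost everywhere
statements be composed. -/
theorem quasiMeasurePreserving (T : HomogBiLip E) :
    Measure.QuasiMeasurePreserving T volume volume := by
  refine ⟨T.continuous.measurable, Measure.AbsolutelyContinuous.mk fun s hs h0 => ?_⟩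
  rw [Measure.map_apply T.continuous.measurable hs]
  obtain ⟨K, hK⟩ := T.symm.lip
  have : T ⁻¹' s = T.symm '' s := (T.toEquiv.image_symm_eq_preimage s).symm
  rw [this]
  exact LipschitzWith.volume_image_eq_zero hK h0

theorem ae_comp (T : HomogBiLip E) {p : E → Prop} (hp : ∀ᵐ x, p x) : ∀ᵐ x, p (T x) :=
  T.quasiMeasurePreserving.ae hp

theorem hasDet_trans {T S : HomogBiLip E} {f g : E → ℝ} (hT : HasDet T f) (hS : HasDet S g) :
    HasDet (T.trans S) (fun x => g (T x) * f x) := by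
  filter_upwards [hT, T.ae_comp hS] with x ⟨D, hD, hDf⟩ ⟨D', hD', hDg⟩
  refine ⟨D'.comp D, hD'.comp x hD, ?_⟩
  rw [← hDf, ← hDg]
  exact LinearMap.det_comp _ _

theorem hasDet_symm {T : HomogBiLip E} {f : E → ℝ} (hT : HasDet T f) (hf : ∀ᵐ x, f x ≠ 0) :
    HasDet T.symm (fun y => (f (T.symm y))⁻¹) := by
  filter_upwards [T.symm.ae_comp hT, T.symm.ae_comp hf] with y ⟨D, hD, hDf⟩ hfy
  have hdet : D.det ≠ 0 := by rw [hDf]; exact hfy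
  set e := D.toContinuousLinearEquivOfDetNeZero hdet
  have he : (e : E →L[ℝ] E) = D := D.coe_toContinuousLinearEquivOfDetNeZero hdet
  refine ⟨e.symm, ?_, ?_⟩
  · apply HasFDerivAt.of_local_left_inverse (f := T) T.symm.continuous.continuousAt
    · rw [he]; exact hD
    · exact Eventually.of_forall fun z => T.apply_symm_apply z
  · rw [ContinuousLinearEquiv.det_coe_symm, he, hDf]

theorem hasDet_ofLinear (L : E ≃L[ℝ] E) :
    HasDet (ofLinear L) (fun _ => (L : E →L[ℝ] E).det) :=
  ae_of_all _ fun _ => ⟨L, L.hasFDerivAt, rfl⟩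

theorem hasDet_congr {T : E → E} {f g : E → ℝ} (hT : HasDet T f) (h : ∀ᵐ x, f x = g x) :
    HasDet T g := by
  filter_upwards [hT, h] with x ⟨D, hD, hDf⟩ hx
  exact ⟨D, hD, hDf.trans hx⟩

end HomogBiLip

theorem ae_ne_zero [Nontrivial E] : ∀ᵐ x : E, x ≠ 0 := by
  have : (volume : Measure E) {(0 : E)} = 0 := by
    simp
  exact compl_mem_ae_iff.2 this

/-- A function of degree zero has derivative zero in the radial direction. -/
theorem HasFDerivAt.apply_self_of_homogeneous {E : Type*} [NormedAddCommGroup E]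
    [NormedSpace ℝ E] {l : E → ℝ} {x : E} {D : E →L[ℝ] ℝ}
    (hD : HasFDerivAt l D x) (hl : ∀ r : ℝ, 0 < r → l (r • x) = l x) : D x = 0 := by
  have h1 : HasDerivAt (fun r : ℝ => r • x) x 1 := by
    simpa using (hasDerivAt_id (1 : ℝ)).smul_const x
  have h2 : HasDerivAt (fun r : ℝ => l (r • x)) (D x) 1 := by
    have hD' : HasFDerivAt l D ((1 : ℝ) • x) := by rwa [one_smul]
    exact hD'.comp_hasDerivAt (1 : ℝ) h1
  have h3 : HasDerivAt (fun r : ℝ => l (r • x)) 0 1 := by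
    refine (hasDerivAt_const (1 : ℝ) (l x)).congr_of_eventuallyEq ?_
    filter_upwards [lt_mem_nhds (zero_lt_one' ℝ)] with r hr using hl r hr
  exact h2.unique h3

/-- The derivative is c · id plus the rank-one map z ↦ D(z) x, with D the derivative of the ratio.
Since D x = 0, this is c times a transvection of determinant 1. -/
theorem HomogBiLip.hasDet_radial [Nontrivial E] {a b : E → ℝ} (ha : IsGauge a) (hb : IsGauge b) :
    HasDet (HomogBiLip.radial ha hb) (fun x => (a x / b x) ^ Module.finrank ℝ E) := by
  obtain ⟨K, hK⟩ := ha.lip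
  obtain ⟨L, hL⟩ := hb.lip
  filter_upwards [hK.ae_differentiableAt (μ := volume), hL.ae_differentiableAt (μ := volume),
    ae_ne_zero (E := E)] with x hax hbx hx
  have ha0 := ha.pos x hx
  have hb0 := hb.pos x hx
  have hl : DifferentiableAt ℝ (fun z => a z / b z) x := by
    simp only [div_eq_mul_inv]
    exact hax.mul (hbx.inv hb0.ne')
  set D := fderiv ℝ (fun z => a z / b z) x
  set c := a x / b x with hc
  have hc0 : c ≠ 0 := (div_pos ha0 hb0).ne'
  have hDx : D x = 0 := hl.hasFDerivAt.apply_self_of_homogeneous fun r hr => by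
    rw [ha.smul r hr.le, hb.smul r hr.le, mul_div_mul_left _ _ hr.ne']
  refine ⟨c • ContinuousLinearMap.id ℝ E + D.smulRight x,
    hl.hasFDerivAt.smul (hasFDerivAt_id x), ?_⟩
  have : ((c • ContinuousLinearMap.id ℝ E + D.smulRight x : E →L[ℝ] E) : E →ₗ[ℝ] E)
      = c • LinearMap.transvection (c⁻¹ • (D : E →ₗ[ℝ] ℝ)) x := by
    ext z
    simp [LinearMap.transvection, smul_smul, hc0]
  rw [ContinuousLinearMap.det, this, LinearMap.det_smul, LinearMap.transvection.det]
  simp [hDx]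

/-- Two gauges are equivalent if some homogeneous bi-Lipschitz bijection of constant positive
Jacobian carries one to the other. -/
def GaugeEquiv (ρ σ : E → ℝ) : Prop :=
  ∃ T : HomogBiLip E, (∀ x, σ (T x) = ρ x) ∧ ∃ k : ℝ, 0 < k ∧ HasDet T (fun _ => k)

theorem GaugeEquiv.symm {ρ σ : E → ℝ} (h : GaugeEquiv ρ σ) : GaugeEquiv σ ρ := by
  obtain ⟨T, hT, k, hk, hd⟩ := h
  exact ⟨T.symm, fun x => by rw [← hT, T.apply_symm_apply], k⁻¹, inv_pos.2 hk,
    HomogBiLip.hasDet_symm hd (ae_of_all _ fun _ => hk.ne')⟩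

theorem GaugeEquiv.trans {ρ σ τ : E → ℝ} (h : GaugeEquiv ρ σ) (h' : GaugeEquiv σ τ) :
    GaugeEquiv ρ τ := by
  obtain ⟨T, hT, k, hk, hd⟩ := h
  obtain ⟨S, hS, l, hl, hd'⟩ := h'
  exact ⟨T.trans S, fun x => by rw [T.trans_apply, hS, hT], l * k, mul_pos hl hk,
    HomogBiLip.hasDet_trans hd hd'⟩

theorem GaugeEquiv.of_linear (σ : E → ℝ) (L : E ≃L[ℝ] E) (hL : 0 < (L : E →L[ℝ] E).det) :
    GaugeEquiv (fun x => σ (L x)) σ :=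
  ⟨HomogBiLip.ofLinear L, fun _ => rfl, _, hL, HomogBiLip.hasDet_ofLinear L⟩

/-- It suffices to match the densities `ρ ^ (-dim)` and `σ ^ (-dim)`. -/
theorem GaugeEquiv.of_density [Nontrivial E] {ρ σ : E → ℝ} (hρ : IsGauge ρ) (hσ : IsGauge σ)
    (T : HomogBiLip E) {k : ℝ} (hk : 0 < k)
    (hT : HasDet T (fun x => k * (σ (T x) / ρ x) ^ Module.finrank ℝ E)) : GaugeEquiv ρ σ := by
  have hσT := hσ.comp T
  -- The radial correction x ↦ (ρ x / σ (T x)) x has exactly the reciprocal density as Jacobian, and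
  -- the density has degree zero, so evaluating it after the correction changes nothing.
  refine ⟨(HomogBiLip.radial hρ hσT).trans T, fun x => ?_, k, hk,
    HomogBiLip.hasDet_congr
      (HomogBiLip.hasDet_trans (HomogBiLip.hasDet_radial hρ hσT) hT) ?_⟩
  · by_cases hx : x = 0
    · rw [hx, HomogBiLip.map_zero, hσ.map_zero, hρ.map_zero]
    have h1 := hρ.pos x hx
    have h2 : 0 < σ (T x) := hσT.pos x hx
    rw [HomogBiLip.trans_apply, HomogBiLip.radial_apply, T.map_smul (by positivity),
      hσ.smul _ (by positivity)]
    field_simp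
  · filter_upwards [ae_ne_zero (E := E)] with x hx
    have h1 := hρ.pos x hx
    have h2 : 0 < σ (T x) := hσT.pos x hx
    have h3 : 0 < ρ x / σ (T x) := div_pos h1 h2
    rw [HomogBiLip.radial_apply, T.map_smul h3.le, hσ.smul _ h3.le, hρ.smul _ h3.le,
      mul_div_mul_left _ _ h3.ne', mul_assoc, ← mul_pow]
    field_simp
    simp

end Jacobian

/-! ### Tail masses on vertical rays, recorded as lengths -/

section TailIntegral

variable {E : Type*} [NormedAddCommGroup E] [NormedSpace ℝ E]

/-- The distance from a point of `E × ℝ` to the ray pointing downwards from the origin. -/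
def apexDist (x : E × ℝ) : ℝ := max ‖x.1‖ (max x.2 0)

theorem apexDist_nonneg (x : E × ℝ) : 0 ≤ apexDist x := (norm_nonneg _).trans (le_max_left _ _)

theorem apexDist_pos {x : E × ℝ} (hx : x.1 ≠ 0) : 0 < apexDist x :=
  (norm_pos_iff.2 hx).trans_le (le_max_left _ _)

theorem apexDist_le_norm (x : E × ℝ) {s : ℝ} (hs : 0 ≤ s) :
    apexDist x ≤ ‖(x.1, x.2 + s)‖ := by
  rw [Prod.norm_mk]
  refine max_le_max le_rfl (max_le ?_ (norm_nonneg _))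
  exact (le_add_of_nonneg_right hs).trans (le_abs_self _)

theorem apexDist_le_add (x y : E × ℝ) : apexDist y ≤ apexDist x + ‖y - x‖ := by
  have h1 : ‖(y - x).1‖ ≤ ‖y - x‖ := norm_fst_le _
  have h2 : ‖(y - x).2‖ ≤ ‖y - x‖ := norm_snd_le _
  have h3 : ‖y.1‖ ≤ ‖x.1‖ + ‖(y - x).1‖ := by
    have := norm_add_le x.1 (y - x).1
    simpa using this
  have h4 : y.2 ≤ x.2 + ‖(y - x).2‖ := by
    have : y.2 - x.2 ≤ |y.2 - x.2| := le_abs_self _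
    simp only [Prod.snd_sub, Real.norm_eq_abs]
    linarith
  have h5 : ‖x.1‖ ≤ apexDist x := le_max_left _ _
  have h6 : x.2 ≤ apexDist x := (le_max_left _ _).trans (le_max_right _ _)
  have h7 := apexDist_nonneg x
  have h8 := norm_nonneg (y - x)
  exact max_le (by linarith) (max_le (by linarith) (by linarith))

/-- The integral of `ρ ^ (-(n+1))` over the upward vertical ray that starts at a point. -/
def tailIntegral (n : ℕ) (ρ : E × ℝ → ℝ) (x : E × ℝ) : ℝ :=
  ∫ s in Ioi (0 : ℝ), (ρ (x.1, x.2 + s) ^ (n + 1))⁻¹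

open scoped Classical in
/-- The `n`-th root of the inverse of the tail integral, normalized to be the height for
`ρ = |·|` on the vertical axis. -/
def tailRadius (n : ℕ) (ρ : E × ℝ → ℝ) (x : E × ℝ) : ℝ :=
  -- On the closed downward axis the upward ray meets the origin; for n ≥ 1 and a gauge ρ the mass
  -- is infinite there, and 0 is the continuous value.
  if apexDist x = 0 then 0 else ((n * tailIntegral n ρ x)⁻¹) ^ ((n : ℝ)⁻¹)

theorem integrableOn_inv_pow_add {n : ℕ} (hn : n ≠ 0) {M : ℝ} (hM : 0 < M) :
    IntegrableOn (fun s : ℝ => ((M + s) ^ (n + 1))⁻¹) (Ioi 0) ∧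
      ∫ s in Ioi (0 : ℝ), ((M + s) ^ (n + 1))⁻¹ = (n * M ^ n)⁻¹ := by
  have hn' : (0 : ℝ) < n := by positivity
  have hd : ∀ s ∈ Ici (0 : ℝ), HasDerivAt (fun s : ℝ => -((n * (M + s) ^ n)⁻¹))
      (((M + s) ^ (n + 1))⁻¹) s := by
    intro s hs
    have hMs : 0 < M + s := by have : (0 : ℝ) ≤ s := hs; linarith
    have h1 : HasDerivAt (fun s : ℝ => (n : ℝ) * (M + s) ^ n) (n * (n * (M + s) ^ (n - 1))) s := by
      have := (((hasDerivAt_id s).const_add M).pow n).const_mul (n : ℝ)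
      simpa using this
    have h2 := (h1.inv (by positivity)).neg
    refine h2.congr_deriv ?_
    obtain ⟨k, rfl⟩ := Nat.exists_eq_succ_of_ne_zero hn
    simp only [Nat.succ_eq_add_one, Nat.add_sub_cancel]
    field_simp
    ring
  have hpos : ∀ s ∈ Ioi (0 : ℝ), 0 ≤ ((M + s) ^ (n + 1))⁻¹ := by
    intro s hs
    have hMs : 0 < M + s := by have : (0 : ℝ) < s := hs; linarith
    positivity
  have hlim : Tendsto (fun s : ℝ => -((n * (M + s) ^ n)⁻¹)) atTop (𝓝 0) := by
    rw [← neg_zero]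
    refine (tendsto_inv_atTop_zero.comp ?_).neg
    refine Tendsto.const_mul_atTop hn' ?_
    exact (tendsto_pow_atTop hn).comp (tendsto_atTop_add_const_left _ M tendsto_id)
  refine ⟨integrableOn_Ioi_deriv_of_nonneg' hd hpos hlim, ?_⟩
  rw [integral_Ioi_of_hasDerivAt_of_nonneg' hd hpos hlim]
  simp

theorem setIntegral_Ioi_comp_add (f : ℝ → ℝ) (t : ℝ) :
    ∫ s in Ioi (0 : ℝ), f (t + s) = ∫ s in Ioi t, f s := by
  have h := (measurePreserving_add_left (volume : Measure ℝ) t).setIntegral_preimage_emb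
    (measurableEmbedding_addLeft t) f (Ioi t)
  rw [← h]
  congr 2
  simp

variable [FiniteDimensional ℝ E] {ρ : E × ℝ → ℝ} {n : ℕ}

theorem IsGauge.integrableOn_tail (hρ : IsGauge ρ) (hn : n ≠ 0) {x : E × ℝ}
    (hx : 0 < apexDist x) :
    IntegrableOn (fun s : ℝ => (ρ (x.1, x.2 + s) ^ (n + 1))⁻¹) (Ioi 0) := by
  obtain ⟨c, hc, hcle⟩ := hρ.exists_ge
  -- Along the ray the norm is at least `apexDist x` and at least s - ‖x‖; κ combines the two bounds
  -- into 1 + s ≤ κ · norm.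
  set κ : ℝ := (1 + ‖x‖) / apexDist x + 1
  have hκ : 0 < κ := by positivity
  have hdom := (integrableOn_inv_pow_add hn one_pos).1.const_mul (((c / κ) ^ (n + 1))⁻¹)
  refine hdom.mono' ?_ ?_
  · have : Measurable fun s : ℝ => (ρ (x.1, x.2 + s) ^ (n + 1))⁻¹ :=
      ((hρ.continuous.comp (by fun_prop : Continuous fun s : ℝ => (x.1, x.2 + s))).measurable.pow_const
        _).inv
    exact this.aestronglyMeasurable
  · refine (ae_restrict_iff' measurableSet_Ioi).2 (ae_of_all _ fun s hs => ?_)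
    have hs0 : (0 : ℝ) < s := hs
    have h1 := apexDist_le_norm x hs0.le
    have h2 : s ≤ ‖x‖ + ‖(x.1, x.2 + s)‖ := by
      have e1 : |x.2| ≤ ‖x‖ := norm_snd_le x
      have e2 : |x.2 + s| ≤ ‖(x.1, x.2 + s)‖ := norm_snd_le (x.1, x.2 + s)
      have e3 := neg_abs_le x.2
      have e4 := le_abs_self (x.2 + s)
      linarith
    have h3 : 1 + s ≤ κ * ‖(x.1, x.2 + s)‖ := by
      have : 1 + ‖x‖ ≤ (1 + ‖x‖) / apexDist x * ‖(x.1, x.2 + s)‖ := by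
        rw [div_mul_eq_mul_div, le_div_iff₀ hx]
        gcongr
      rw [add_mul, one_mul]
      linarith
    have h4 : c / κ * (1 + s) ≤ ρ (x.1, x.2 + s) := by
      refine le_trans ?_ (hcle _)
      rw [div_mul_eq_mul_div, div_le_iff₀ hκ]
      nlinarith
    have h5 : 0 < c / κ * (1 + s) := by positivity
    rw [Real.norm_of_nonneg (inv_nonneg.2 (pow_nonneg (hρ.nonneg _) _)), ← mul_inv, ← mul_pow]
    gcongr

theorem tailIntegral_eq_integral_Ioi (y : E) (t : ℝ) :
    tailIntegral n ρ (y, t) = ∫ s in Ioi t, (ρ (y, s) ^ (n + 1))⁻¹ :=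
  setIntegral_Ioi_comp_add (fun s => (ρ (y, s) ^ (n + 1))⁻¹) t

theorem integrableOn_Ioi_comp_add {f : ℝ → ℝ} {t : ℝ} :
    IntegrableOn (fun s => f (t + s)) (Ioi 0) ↔ IntegrableOn f (Ioi t) := by
  have h := (measurePreserving_add_left (volume : Measure ℝ) t).integrableOn_comp_preimage
    (measurableEmbedding_addLeft t) (f := f) (s := Ioi t)
  rw [← h]
  simp only [preimage_const_add_Ioi, sub_self]
  rfl

/-- Raising the starting height to max t 0 only discards mass, and on the remaining ray the norm is
at most `apexDist x + s`, which leaves the model integral. -/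
theorem IsGauge.tailIntegral_ge (hρ : IsGauge ρ) (hn : n ≠ 0) {C : ℝ} (hC : 0 < C)
    (hCle : ∀ x, ρ x ≤ C * ‖x‖) {x : E × ℝ} (hx : 0 < apexDist x) :
    (C ^ (n + 1) * (n * apexDist x ^ n))⁻¹ ≤ tailIntegral n ρ x := by
  obtain ⟨y, t⟩ := x
  set m := apexDist (y, t) with hm
  have hxt : apexDist (y, max t 0) = m := by simp [hm, apexDist]
  have hint := hρ.integrableOn_tail hn hx
  have hint' := hρ.integrableOn_tail hn (x := (y, max t 0)) (by rw [hxt]; exact hx)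
  have h1 : tailIntegral n ρ (y, max t 0) ≤ tailIntegral n ρ (y, t) := by
    rw [tailIntegral_eq_integral_Ioi, tailIntegral_eq_integral_Ioi]
    refine setIntegral_mono_set (integrableOn_Ioi_comp_add.1 hint) ?_ ?_
    · exact ae_of_all _ fun s => inv_nonneg.2 (pow_nonneg (hρ.nonneg _) _)
    · exact (Ioi_subset_Ioi (le_max_left _ _)).eventuallyLE
  refine le_trans ?_ h1
  rw [mul_inv, ← (integrableOn_inv_pow_add hn hx).2, ← integral_const_mul]
  refine setIntegral_mono_on ((integrableOn_inv_pow_add hn hx).1.const_mul _) hint'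
    measurableSet_Ioi fun s hs => ?_
  have hs0 : (0 : ℝ) < s := hs
  have hnorm : ‖(y, max t 0 + s)‖ ≤ m + s := by
    rw [Prod.norm_mk, Real.norm_of_nonneg (add_nonneg (le_max_right _ _) hs0.le)]
    refine max_le ?_ ?_
    · exact (le_max_left _ _).trans (le_add_of_nonneg_right hs0.le)
    · gcongr
      exact le_max_right _ _
  have hne : (y, max t 0 + s) ≠ 0 := by
    intro h
    have := congrArg Prod.snd h
    simp only [Prod.snd_zero] at this
    linarith [le_max_right t 0]
  have hpos := hρ.pos _ hne
  rw [← mul_inv, ← mul_pow]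
  gcongr
  exact (hCle _).trans (by gcongr)

theorem IsGauge.tailIntegral_pos (hρ : IsGauge ρ) (hn : n ≠ 0) {x : E × ℝ}
    (hx : 0 < apexDist x) : 0 < tailIntegral n ρ x := by
  obtain ⟨C, hC, hCle⟩ := hρ.exists_le
  refine lt_of_lt_of_le ?_ (hρ.tailIntegral_ge hn hC hCle hx)
  positivity

theorem IsGauge.tailIntegral_le (hρ : IsGauge ρ) (hn : n ≠ 0) {c : ℝ} (hc : 0 < c)
    (hcle : ∀ x, c * ‖x‖ ≤ ρ x) {x : E × ℝ} (hx : x ≠ 0) (ht : 0 ≤ x.2) :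
    tailIntegral n ρ x ≤ ((c / 2) ^ (n + 1) * (n * ‖x‖ ^ n))⁻¹ := by
  have hx0 : 0 < ‖x‖ := norm_pos_iff.2 hx
  have hm : apexDist x = ‖x‖ := by
    rw [apexDist, Prod.norm_def, max_eq_left ht, Real.norm_of_nonneg ht]
  rw [mul_inv, ← (integrableOn_inv_pow_add hn hx0).2, ← integral_const_mul]
  refine setIntegral_mono_on (hρ.integrableOn_tail hn (by rw [hm]; exact hx0))
    ((integrableOn_inv_pow_add hn hx0).1.const_mul _) measurableSet_Ioi fun s hs => ?_
  have hs0 : (0 : ℝ) < s := hs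
  have h1 : ‖x‖ + s ≤ 2 * ‖(x.1, x.2 + s)‖ := by
    have e1 : ‖x‖ ≤ ‖(x.1, x.2 + s)‖ := by
      rw [← hm]; exact apexDist_le_norm x hs0.le
    have e2 : |x.2 + s| ≤ ‖(x.1, x.2 + s)‖ := norm_snd_le (x.1, x.2 + s)
    have e4 := le_abs_self (x.2 + s)
    linarith
  rw [← mul_inv, ← mul_pow]
  gcongr
  refine le_trans ?_ (hcle _)
  nlinarith

theorem tailRadius_nonneg (hρ : IsGauge ρ) (x : E × ℝ) : 0 ≤ tailRadius n ρ x := by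
  unfold tailRadius
  split_ifs
  · exact le_rfl
  · refine Real.rpow_nonneg (inv_nonneg.2 (mul_nonneg (by positivity) ?_)) _
    exact integral_nonneg fun s => inv_nonneg.2 (pow_nonneg (hρ.nonneg _) _)

theorem IsGauge.tailRadius_pow (hρ : IsGauge ρ) (hn : n ≠ 0) {x : E × ℝ}
    (hx : 0 < apexDist x) : tailRadius n ρ x ^ n = (n * tailIntegral n ρ x)⁻¹ := by
  have := hρ.tailIntegral_pos hn hx
  rw [tailRadius, if_neg hx.ne', Real.rpow_inv_natCast_pow (by positivity) hn]

theorem IsGauge.tailRadius_pos (hρ : IsGauge ρ) (hn : n ≠ 0) {x : E × ℝ}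
    (hx : 0 < apexDist x) : 0 < tailRadius n ρ x := by
  have := hρ.tailIntegral_pos hn hx
  rw [tailRadius, if_neg hx.ne']
  positivity

theorem IsGauge.exists_tailRadius_le (hρ : IsGauge ρ) (hn : n ≠ 0) :
    ∃ C, 0 < C ∧ ∀ x, tailRadius n ρ x ≤ C * apexDist x := by
  obtain ⟨C₀, hC₀, hC₀le⟩ := hρ.exists_le
  -- With C ≥ 1, the factor C^(n+1) is at most the n-th power (C^2)^n.
  set C := C₀ + 1
  have hC : 1 ≤ C := by simp only [C]; linarith
  have hCle : ∀ x, ρ x ≤ C * ‖x‖ := fun x => (hC₀le x).trans (by gcongr; simp [C])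
  refine ⟨C ^ 2, by positivity, fun x => ?_⟩
  rcases (apexDist_nonneg x).eq_or_lt with h0 | hx
  · rw [tailRadius, if_pos h0.symm, ← h0, mul_zero]
  have hF := hρ.tailIntegral_pos hn hx
  have hge := hρ.tailIntegral_ge hn (by positivity) hCle hx
  refine le_of_pow_le_pow_left₀ hn (by positivity) ?_
  rw [hρ.tailRadius_pow hn hx]
  have hn' : (0 : ℝ) < n := by positivity
  calc (n * tailIntegral n ρ x)⁻¹ ≤ (n * (C ^ (n + 1) * (n * apexDist x ^ n))⁻¹)⁻¹ := by
        gcongr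
    _ = C ^ (n + 1) * apexDist x ^ n := by field_simp
    _ ≤ C ^ (2 * n) * apexDist x ^ n := by
        gcongr
        omega
    _ = (C ^ 2 * apexDist x) ^ n := by rw [mul_pow, pow_mul]

theorem IsGauge.exists_le_tailRadius (hρ : IsGauge ρ) (hn : n ≠ 0) :
    ∃ c, 0 < c ∧ ∀ x : E × ℝ, 0 ≤ x.2 → c * ‖x‖ ≤ tailRadius n ρ x := by
  obtain ⟨c₀, hc₀, hc₀le⟩ := hρ.exists_ge
  -- With c / 2 ≤ 1, the n-th power ((c/2)^2)^n is at most (c/2)^(n+1).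
  set c := min c₀ 1
  have hc : 0 < c := by positivity
  have hc1 : c / 2 ≤ 1 := by linarith [min_le_right c₀ 1]
  have hcle : ∀ x, c * ‖x‖ ≤ ρ x := fun x =>
    (mul_le_mul_of_nonneg_right (min_le_left _ _) (norm_nonneg _)).trans (hc₀le x)
  refine ⟨(c / 2) ^ 2, by positivity, fun x ht => ?_⟩
  by_cases hx : x = 0
  · rw [hx, norm_zero, mul_zero]; exact tailRadius_nonneg hρ _
  have hx0 : 0 < ‖x‖ := norm_pos_iff.2 hx
  have hm : apexDist x = ‖x‖ := by
    rw [apexDist, Prod.norm_def, max_eq_left ht, Real.norm_of_nonneg ht]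
  have hm0 : 0 < apexDist x := by rw [hm]; exact hx0
  have hF := hρ.tailIntegral_pos hn hm0
  have hle := hρ.tailIntegral_le hn hc hcle hx ht
  refine le_of_pow_le_pow_left₀ hn (tailRadius_nonneg hρ _) ?_
  rw [hρ.tailRadius_pow hn hm0]
  have hn' : (0 : ℝ) < n := by positivity
  calc ((c / 2) ^ 2 * ‖x‖) ^ n = (c / 2) ^ (2 * n) * ‖x‖ ^ n := by rw [mul_pow, pow_mul]
    _ ≤ (c / 2) ^ (n + 1) * ‖x‖ ^ n := by
        gcongr ?_ * _
        exact pow_le_pow_of_le_one (by positivity) hc1 (by omega)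
    _ = (n * ((c / 2) ^ (n + 1) * (n * ‖x‖ ^ n))⁻¹)⁻¹ := by field_simp
    _ ≤ (n * tailIntegral n ρ x)⁻¹ := by gcongr

/-- Let δ be the distance of the two points. If `apexDist x ≤ δ`, the linear upper bound gives 2Cδ.
Otherwise ρ grows along the translated ray by a factor at most 1 + z with z = a δ / `apexDist x`, so
the radius grows by at most (1 + z)^2, and z times the radius is at most a C δ. -/
theorem IsGauge.tailRadius_lipschitz (hρ : IsGauge ρ) (hn : n ≠ 0) :
    ∃ K, LipschitzWith K (tailRadius n ρ) := by
  obtain ⟨L, hL⟩ := hρ.lip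
  obtain ⟨c, hc, hcle⟩ := hρ.exists_ge
  obtain ⟨C, hC, hCle⟩ := hρ.exists_tailRadius_le hn
  set a : ℝ := L / c
  have ha : 0 ≤ a := by positivity
  set K : ℝ := 2 * C + (2 + a) * a * C
  have hK : 0 ≤ K := by positivity
  have key : ∀ x x', tailRadius n ρ x' ≤ tailRadius n ρ x + K * dist x' x := by
    intro x x'
    rw [dist_eq_norm]
    set δ := ‖x' - x‖
    have hδ : 0 ≤ δ := norm_nonneg _
    have hU := tailRadius_nonneg (n := n) hρ x
    rcases le_or_gt (apexDist x) δ with hm | hm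
    · have h1 := hCle x'
      have h2 := apexDist_le_add x x'
      have h3 : C * apexDist x' ≤ C * (δ + δ) := by gcongr; linarith
      have h4 : 2 * C * δ ≤ K * δ := by
        gcongr
        simp only [K]
        have : 0 ≤ (2 + a) * a * C := by positivity
        linarith
      nlinarith
    · have hm0 : 0 < apexDist x := hδ.trans_lt hm
      have hm' : 0 < apexDist x' := by
        have := apexDist_le_add x' x
        rw [norm_sub_rev] at this
        linarith
      set z : ℝ := a * (δ / apexDist x)
      have hz : 0 ≤ z := by positivity
      have hza : z ≤ a := by
        have : δ / apexDist x ≤ 1 := (div_le_one hm0).2 hm.le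
        nlinarith
      have hF := hρ.tailIntegral_pos hn hm0
      have hF' := hρ.tailIntegral_pos hn hm'
      have hFF : ((1 + z) ^ (n + 1))⁻¹ * tailIntegral n ρ x ≤ tailIntegral n ρ x' := by
        rw [tailIntegral, ← integral_const_mul]
        refine setIntegral_mono_on ((hρ.integrableOn_tail hn hm0).const_mul _)
          (hρ.integrableOn_tail hn hm') measurableSet_Ioi fun s hs => ?_
        have hs0 : (0 : ℝ) < s := hs
        have h1 := (apexDist_le_norm x hs0.le)
        have h1' := (apexDist_le_norm x' hs0.le)
        have h2 := hcle (x.1, x.2 + s)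
        have hp' : 0 < ρ (x'.1, x'.2 + s) :=
          (mul_pos hc (hm'.trans_le h1')).trans_le (hcle _)
        have h3 : ρ (x'.1, x'.2 + s) ≤ ρ (x.1, x.2 + s) + L * δ := by
          have := hL.dist_le_mul (x'.1, x'.2 + s) (x.1, x.2 + s)
          have e : dist (x'.1, x'.2 + s) (x.1, x.2 + s) = δ := by
            rw [dist_eq_norm]
            simp only [δ]
            congr 1
            ext <;> simp
          rw [e, Real.dist_eq] at this
          linarith [le_abs_self (ρ (x'.1, x'.2 + s) - ρ (x.1, x.2 + s))]
        have h4 : L * δ ≤ z * ρ (x.1, x.2 + s) := by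
          have : z * (c * apexDist x) = L * δ := by
            simp only [z, a]; field_simp
          rw [← this]
          gcongr
          exact (mul_le_mul_of_nonneg_left h1 hc.le).trans h2
        rw [← mul_inv, ← mul_pow]
        gcongr
        linarith
      have hstep : tailRadius n ρ x' ≤ (1 + z) ^ 2 * tailRadius n ρ x := by
        refine le_of_pow_le_pow_left₀ hn (by positivity) ?_
        rw [mul_pow, hρ.tailRadius_pow hn hm0, hρ.tailRadius_pow hn hm']
        have hn' : (0 : ℝ) < n := by positivity
        calc (n * tailIntegral n ρ x')⁻¹
            ≤ (n * (((1 + z) ^ (n + 1))⁻¹ * tailIntegral n ρ x))⁻¹ := by gcongr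
          _ = (1 + z) ^ (n + 1) * (n * tailIntegral n ρ x)⁻¹ := by field_simp
          _ ≤ ((1 + z) ^ 2) ^ n * (n * tailIntegral n ρ x)⁻¹ := by
              rw [← pow_mul]
              gcongr
              · linarith
              · omega
      have hzU : z * tailRadius n ρ x ≤ a * C * δ := by
        calc z * tailRadius n ρ x ≤ z * (C * apexDist x) := by gcongr; exact hCle x
          _ = a * C * δ := by simp only [z]; field_simp
      calc tailRadius n ρ x' ≤ (1 + z) ^ 2 * tailRadius n ρ x := hstep
        _ = tailRadius n ρ x + (2 + z) * (z * tailRadius n ρ x) := by ring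
        _ ≤ tailRadius n ρ x + (2 + a) * (a * C * δ) := by gcongr
        _ ≤ tailRadius n ρ x + K * δ := by
            have : K * δ = 2 * C * δ + (2 + a) * (a * C * δ) := by simp only [K]; ring
            rw [this]
            have : 0 ≤ 2 * C * δ := by positivity
            linarith
  refine ⟨K.toNNReal, LipschitzWith.of_dist_le_mul fun x y => ?_⟩
  rw [Real.coe_toNNReal _ hK, Real.dist_eq, abs_sub_le_iff]
  have h1 := key x y
  have h2 := key y x
  rw [dist_comm] at h1
  constructor <;> linarith

theorem apexDist_smul {r : ℝ} (hr : 0 ≤ r) (x : E × ℝ) : apexDist (r • x) = r * apexDist x := by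
  simp only [apexDist, Prod.smul_fst, Prod.smul_snd, norm_smul, Real.norm_of_nonneg hr,
    smul_eq_mul]
  rw [mul_max_of_nonneg _ _ hr, mul_max_of_nonneg _ _ hr, mul_zero]

theorem IsGauge.tailRadius_smul (hρ : IsGauge ρ) (hn : n ≠ 0) {r : ℝ} (hr : 0 ≤ r) (x : E × ℝ) :
    tailRadius n ρ (r • x) = r * tailRadius n ρ x := by
  rcases hr.eq_or_lt with rfl | hr'
  · simp [tailRadius, apexDist]
  rcases (apexDist_nonneg x).eq_or_lt with h0 | hx
  · rw [tailRadius, tailRadius, apexDist_smul hr, if_pos h0.symm, if_pos (by rw [← h0, mul_zero]),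
      mul_zero]
  have hx' : 0 < apexDist (r • x) := by rw [apexDist_smul hr]; positivity
  have hF := hρ.tailIntegral_pos hn hx
  have hI : tailIntegral n ρ (r • x) = (r ^ n)⁻¹ * tailIntegral n ρ x := by
    have h := integral_comp_mul_left_Ioi
      (fun s => (ρ ((r • x).1, (r • x).2 + s) ^ (n + 1))⁻¹) 0 hr'
    rw [mul_zero, smul_eq_mul] at h
    have h2 : tailIntegral n ρ (r • x) = r * ∫ s in Ioi (0 : ℝ),
        (ρ ((r • x).1, (r • x).2 + r * s) ^ (n + 1))⁻¹ := by
      rw [h, tailIntegral]; field_simp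
    rw [h2, tailIntegral, ← integral_const_mul, ← integral_const_mul]
    congr 1
    ext s
    have : ((r • x).1, (r • x).2 + r * s) = r • (x.1, x.2 + s) := by
      ext <;> simp [mul_add]
    rw [this, hρ.smul r hr, mul_pow, mul_inv, pow_succ]
    field_simp
  refine (pow_left_inj₀ (tailRadius_nonneg hρ _)
    (mul_nonneg hr (tailRadius_nonneg hρ _)) hn).1 ?_
  rw [mul_pow, hρ.tailRadius_pow hn hx, hρ.tailRadius_pow hn hx', hI]
  field_simp

theorem IsGauge.continuous_fiber (hρ : IsGauge ρ) {y : E} (hy : y ≠ 0) :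
    Continuous fun s : ℝ => (ρ (y, s) ^ (n + 1))⁻¹ := by
  refine ((hρ.continuous.comp (by fun_prop : Continuous fun s : ℝ => (y, s))).pow _).inv₀
    fun s => (pow_pos (hρ.pos _ fun h => hy (congrArg Prod.fst h)) _).ne'

theorem IsGauge.hasDerivAt_tailIntegral (hρ : IsGauge ρ) (hn : n ≠ 0) {y : E} (hy : y ≠ 0)
    (t : ℝ) : HasDerivAt (fun t => tailIntegral n ρ (y, t)) (-(ρ (y, t) ^ (n + 1))⁻¹) t := by
  have hcont := hρ.continuous_fiber (n := n) hy
  have hint : ∀ t : ℝ, IntegrableOn (fun s : ℝ => (ρ (y, s) ^ (n + 1))⁻¹) (Ioi t) := fun t =>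
    integrableOn_Ioi_comp_add.1 (hρ.integrableOn_tail hn (x := (y, t)) (apexDist_pos hy))
  have heq : (fun t => tailIntegral n ρ (y, t)) = fun t => tailIntegral n ρ (y, 0) -
      ∫ s in (0 : ℝ)..t, (ρ (y, s) ^ (n + 1))⁻¹ := by
    ext t
    rw [tailIntegral_eq_integral_Ioi, tailIntegral_eq_integral_Ioi,
      ← intervalIntegral.integral_Ioi_sub_Ioi' (hint 0) (hint t), sub_sub_cancel]
  rw [heq]
  exact (hcont.integral_hasStrictDerivAt 0 t).hasDerivAt.const_sub _

/-- The tail mass F has derivative -ρ^(-(n+1)); differentiate (nF)^(-1/n). The condition y ≠ 0 keeps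
the line away from the origin. -/
theorem IsGauge.hasDerivAt_tailRadius (hρ : IsGauge ρ) (hn : n ≠ 0) {y : E} (hy : y ≠ 0)
    (t : ℝ) : HasDerivAt (fun t => tailRadius n ρ (y, t))
      ((tailRadius n ρ (y, t) / ρ (y, t)) ^ (n + 1)) t := by
  have hF := hρ.tailIntegral_pos hn (x := (y, t)) (apexDist_pos hy)
  have hU := hρ.tailRadius_pos hn (x := (y, t)) (apexDist_pos hy)
  have hp := hρ.tailRadius_pow hn (x := (y, t)) (apexDist_pos hy)
  have hρ0 : 0 < ρ (y, t) := hρ.pos _ fun h => hy (congrArg Prod.fst h)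
  have hn' : (0 : ℝ) < n := by positivity
  have h1 := ((hρ.hasDerivAt_tailIntegral hn hy t).const_mul (n : ℝ)).fun_inv (by positivity)
  have h2 := h1.rpow_const (p := (n : ℝ)⁻¹) (Or.inl (by positivity))
  have heq : (fun t => tailRadius n ρ (y, t)) =
      fun t => ((n * tailIntegral n ρ (y, t))⁻¹) ^ ((n : ℝ)⁻¹) := by
    ext t
    rw [tailRadius, if_neg (apexDist_pos hy).ne']
  have hUval : ((n * tailIntegral n ρ (y, t))⁻¹) ^ ((n : ℝ)⁻¹) = tailRadius n ρ (y, t) := by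
    rw [tailRadius, if_neg (apexDist_pos hy).ne']
  rw [heq]
  refine h2.congr_deriv ?_
  rw [Real.rpow_sub_one (by positivity), hUval]
  rw [div_pow, pow_succ (tailRadius n ρ (y, t)), hp]
  field_simp

end TailIntegral

/-! ### Shears along the vertical direction -/

section Shear

variable {E : Type*} [NormedAddCommGroup E] [NormedSpace ℝ E]

/-- The map `(y, t) ↦ (y, v (y, t))`, where `v` is Lipschitz, homogeneous, and increases in `t`
at a rate bounded below. -/
def HomogBiLip.shear (v : E × ℝ → ℝ) (hv : ∃ K, LipschitzWith K v)
    (hsmul : ∀ r : ℝ, 0 ≤ r → ∀ x, v (r • x) = r * v x)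
    (hmono : ∃ c, 0 < c ∧ ∀ (y : E) (s t : ℝ), s ≤ t → c * (t - s) ≤ v (y, t) - v (y, s)) :
    HomogBiLip (E × ℝ) :=
  -- Moving first at fixed y and then at fixed height gives c |t - t'| ≤ |v - v'| + K dist y y', so
  -- the image pair controls t.
  have hanti : ∃ K, AntilipschitzWith K (fun x : E × ℝ => (x.1, v x)) := by
    obtain ⟨K, hK⟩ := hv
    obtain ⟨c, hc, hcle⟩ := hmono
    set L : ℝ := 1 + (1 + K) / c
    have hL : 0 ≤ L := by positivity
    refine ⟨L.toNNReal, AntilipschitzWith.of_le_mul_dist fun x x' => ?_⟩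
    rw [Real.coe_toNNReal _ hL]
    obtain ⟨y, t⟩ := x
    obtain ⟨y', t'⟩ := x'
    set d := dist ((y, v (y, t)) : E × ℝ) (y', v (y', t'))
    have h1 : dist y y' ≤ d := le_max_left _ _
    have h2 : |v (y, t) - v (y', t')| ≤ d := le_max_right _ _
    have h3 : |v (y, t') - v (y', t')| ≤ K * dist y y' := by
      have := hK.dist_le_mul (y, t') (y', t')
      rw [Real.dist_eq, Prod.dist_eq, dist_self, max_eq_left dist_nonneg] at this
      exact this
    have h4 : c * |t - t'| ≤ |v (y, t) - v (y, t')| := by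
      rcases le_total t t' with h | h
      · have := hcle y t t' h
        rw [abs_sub_comm t, abs_of_nonneg (sub_nonneg.2 h), abs_sub_comm]
        exact this.trans (le_abs_self _)
      · have := hcle y t' t h
        rw [abs_of_nonneg (sub_nonneg.2 h)]
        exact this.trans (le_abs_self _)
    have h5 : |v (y, t) - v (y, t')| ≤ |v (y, t) - v (y', t')| + |v (y, t') - v (y', t')| := by
      rw [abs_sub_comm (v (y, t'))]
      exact abs_sub_le _ _ _
    have h6 : c * |t - t'| ≤ (1 + K) * d := by
      have : K * dist y y' ≤ K * d := by gcongr
      linarith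
    have hd : 0 ≤ d := dist_nonneg
    have h7 : |t - t'| ≤ (1 + K) / c * d := by
      rw [div_mul_eq_mul_div, le_div_iff₀ hc]; linarith
    have hKd : 0 ≤ (1 + K) / c * d := by positivity
    rw [Prod.dist_eq]
    refine max_le ?_ ?_
    · simp only [L, add_mul, one_mul]; linarith
    · rw [Real.dist_eq]; simp only [L, add_mul, one_mul]; linarith
  have hbij : Function.Bijective (fun x : E × ℝ => (x.1, v x)) := by
    refine ⟨hanti.choose_spec.injective, fun ⟨y, w⟩ => ?_⟩
    obtain ⟨K, hK⟩ := hv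
    obtain ⟨c, hc, hcle⟩ := hmono
    -- Each fiber function is continuous and grows at least linearly at both ends, hence is onto.
    have hcont : Continuous fun t : ℝ => v (y, t) := hK.continuous.comp (by fun_prop)
    have htop : Tendsto (fun t : ℝ => v (y, t)) atTop atTop := by
      refine tendsto_atTop_mono' atTop ?_
        (tendsto_atTop_add_const_right _ (v (y, 0)) (tendsto_id.const_mul_atTop hc))
      filter_upwards [eventually_ge_atTop 0] with t ht
      have := hcle y 0 t ht
      simp only [id_eq]
      linarith
    have hbot : Tendsto (fun t : ℝ => v (y, t)) atBot atBot := by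
      refine tendsto_atBot_mono' atBot ?_
        (tendsto_atBot_add_const_right _ (v (y, 0)) (tendsto_id.const_mul_atBot hc))
      filter_upwards [eventually_le_atBot 0] with t ht
      have := hcle y t 0 ht
      simp only [id_eq]
      linarith
    obtain ⟨t, ht⟩ := hcont.surjective htop hbot w
    exact ⟨(y, t), Prod.ext rfl ht⟩
  { toEquiv := Equiv.ofBijective _ hbij
    lip := by
      obtain ⟨K, hK⟩ := hv
      exact ⟨_, LipschitzWith.prod_fst.prodMk hK⟩
    lip_symm := by
      obtain ⟨K, hK⟩ := hanti
      exact ⟨K, hK.to_rightInverse (Equiv.ofBijective _ hbij).right_inv⟩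
    map_smul' := fun r hr x => by
      change ((r • x).1, v (r • x)) = r • (x.1, v x)
      rw [hsmul r hr]
      rfl }

end Shear

/-! ### The balanced height and the fiber radius -/

section Vertical

variable {E : Type*} [NormedAddCommGroup E] [NormedSpace ℝ E]

/-- The reflection `(y, t) ↦ (y, -t)`. -/
def verticalReflection (E : Type*) [NormedAddCommGroup E] [NormedSpace ℝ E] :
    (E × ℝ) ≃L[ℝ] (E × ℝ) :=
  (ContinuousLinearEquiv.refl ℝ E).prodCongr (ContinuousLinearEquiv.neg ℝ)

theorem verticalReflection_apply (x : E × ℝ) : verticalReflection E x = (x.1, -x.2) := rfl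

/-- The analogue of `tailRadius` for the downward vertical rays. -/
def lowerRadius (n : ℕ) (ρ : E × ℝ → ℝ) (x : E × ℝ) : ℝ :=
  tailRadius n (fun z => ρ (verticalReflection E z)) (verticalReflection E x)

/-- The difference of the upper and the lower radius. -/
def balancedHeight (n : ℕ) (ρ : E × ℝ → ℝ) (x : E × ℝ) : ℝ :=
  tailRadius n ρ x - lowerRadius n ρ x

variable [FiniteDimensional ℝ E] {ρ : E × ℝ → ℝ} {n : ℕ}

theorem IsGauge.reflect (hρ : IsGauge ρ) : IsGauge (fun z => ρ (verticalReflection E z)) :=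
  hρ.comp_linear _

theorem IsGauge.lowerRadius_nonneg (hρ : IsGauge ρ) (x : E × ℝ) : 0 ≤ lowerRadius n ρ x :=
  tailRadius_nonneg hρ.reflect _

theorem IsGauge.lowerRadius_pos (hρ : IsGauge ρ) (hn : n ≠ 0) {x : E × ℝ} (hx : x.1 ≠ 0) :
    0 < lowerRadius n ρ x :=
  hρ.reflect.tailRadius_pos hn (apexDist_pos hx)

theorem IsGauge.lowerRadius_smul (hρ : IsGauge ρ) (hn : n ≠ 0) {r : ℝ} (hr : 0 ≤ r)
    (x : E × ℝ) : lowerRadius n ρ (r • x) = r * lowerRadius n ρ x := by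
  rw [lowerRadius, _root_.map_smul, hρ.reflect.tailRadius_smul hn hr, lowerRadius]

theorem IsGauge.lowerRadius_lipschitz (hρ : IsGauge ρ) (hn : n ≠ 0) :
    ∃ K, LipschitzWith K (lowerRadius n ρ) := by
  obtain ⟨K, hK⟩ := hρ.reflect.tailRadius_lipschitz hn
  exact ⟨_, hK.comp (verticalReflection E).lipschitz⟩

theorem IsGauge.hasDerivAt_lowerRadius (hρ : IsGauge ρ) (hn : n ≠ 0) {y : E} (hy : y ≠ 0)
    (t : ℝ) : HasDerivAt (fun t => lowerRadius n ρ (y, t))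
      (-(lowerRadius n ρ (y, t) / ρ (y, t)) ^ (n + 1)) t := by
  have h := (hρ.reflect.hasDerivAt_tailRadius hn hy (-t)).comp t (hasDerivAt_neg t)
  refine h.congr_deriv ?_
  rw [verticalReflection_apply, neg_neg, mul_neg, mul_one]
  rfl

theorem IsGauge.balancedHeight_lipschitz (hρ : IsGauge ρ) (hn : n ≠ 0) :
    ∃ K, LipschitzWith K (balancedHeight n ρ) := by
  obtain ⟨K, hK⟩ := hρ.tailRadius_lipschitz hn
  obtain ⟨L, hL⟩ := hρ.lowerRadius_lipschitz hn
  exact ⟨_, hK.sub hL⟩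

theorem IsGauge.balancedHeight_smul (hρ : IsGauge ρ) (hn : n ≠ 0) (r : ℝ) (hr : 0 ≤ r)
    (x : E × ℝ) : balancedHeight n ρ (r • x) = r * balancedHeight n ρ x := by
  rw [balancedHeight, hρ.tailRadius_smul hn hr, hρ.lowerRadius_smul hn hr, balancedHeight, mul_sub]

/-- The vertical derivative of `balancedHeight`. -/
def heightRate (n : ℕ) (ρ : E × ℝ → ℝ) (x : E × ℝ) : ℝ :=
  (tailRadius n ρ x ^ (n + 1) + lowerRadius n ρ x ^ (n + 1)) / ρ x ^ (n + 1)

theorem IsGauge.hasDerivAt_balancedHeight (hρ : IsGauge ρ) (hn : n ≠ 0) {y : E} (hy : y ≠ 0)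
    (t : ℝ) : HasDerivAt (fun t => balancedHeight n ρ (y, t)) (heightRate n ρ (y, t)) t := by
  refine ((hρ.hasDerivAt_tailRadius hn hy t).sub
    (hρ.hasDerivAt_lowerRadius hn hy t)).congr_deriv ?_
  rw [heightRate, div_pow, div_pow, add_div]
  ring

/-- Each radius alone degenerates near one half of the axis. The upper one is comparable to ‖x‖ for
t ≥ 0 and the lower one for t ≤ 0, so the sum never degenerates; this is why the height uses both.
-/
theorem IsGauge.exists_le_heightRate (hρ : IsGauge ρ) (hn : n ≠ 0) :
    ∃ c, 0 < c ∧ ∀ x : E × ℝ, x ≠ 0 → c ≤ heightRate n ρ x := by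
  obtain ⟨c₁, hc₁, h₁⟩ := hρ.exists_le_tailRadius hn
  obtain ⟨c₂, hc₂, h₂⟩ := hρ.reflect.exists_le_tailRadius hn
  obtain ⟨C, hC, hCle⟩ := hρ.exists_le
  set c := min c₁ c₂
  have hc : 0 < c := lt_min hc₁ hc₂
  refine ⟨(c / C) ^ (n + 1), by positivity, fun x hx => ?_⟩
  have hρ0 := hρ.pos x hx
  have hU := tailRadius_nonneg (n := n) hρ x
  have hV := hρ.lowerRadius_nonneg (n := n) x
  have hnum : (c * ‖x‖) ^ (n + 1) ≤
      tailRadius n ρ x ^ (n + 1) + lowerRadius n ρ x ^ (n + 1) := by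
    rcases le_total 0 x.2 with ht | ht
    · have : c * ‖x‖ ≤ tailRadius n ρ x :=
        (mul_le_mul_of_nonneg_right (min_le_left _ _) (norm_nonneg _)).trans (h₁ x ht)
      have := pow_le_pow_left₀ (by positivity) this (n + 1)
      have := pow_nonneg hV (n + 1)
      linarith
    · have hnorm : ‖verticalReflection E x‖ = ‖x‖ := by
        rw [verticalReflection_apply, Prod.norm_mk, norm_neg, Prod.norm_def]
      have h3 := h₂ (verticalReflection E x) (by simpa [verticalReflection_apply] using ht)
      rw [hnorm] at h3
      have : c * ‖x‖ ≤ lowerRadius n ρ x :=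
        (mul_le_mul_of_nonneg_right (min_le_right _ _) (norm_nonneg _)).trans h3
      have := pow_le_pow_left₀ (by positivity) this (n + 1)
      have := pow_nonneg hU (n + 1)
      linarith
  rw [heightRate, le_div_iff₀ (by positivity)]
  refine le_trans ?_ hnum
  rw [← mul_pow]
  refine pow_le_pow_left₀ (by positivity) ?_ _
  calc c / C * ρ x ≤ c / C * (C * ‖x‖) := by gcongr; exact hCle x
    _ = c * ‖x‖ := by field_simp

/-- For y ≠ 0 this integrates the bound on the rate. The axis y = 0 follows by continuity, the
complement of the origin being dense in a nontrivial space. -/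
theorem IsGauge.exists_balancedHeight_mono [Nontrivial E] (hρ : IsGauge ρ) (hn : n ≠ 0) :
    ∃ c, 0 < c ∧ ∀ (y : E) (s t : ℝ), s ≤ t →
      c * (t - s) ≤ balancedHeight n ρ (y, t) - balancedHeight n ρ (y, s) := by
  obtain ⟨c, hc, hcle⟩ := hρ.exists_le_heightRate hn
  refine ⟨c, hc, fun y s t hst => ?_⟩
  have hcont := (hρ.balancedHeight_lipschitz hn).choose_spec.continuous
  have hclosed : IsClosed {y : E | c * (t - s) ≤
      balancedHeight n ρ (y, t) - balancedHeight n ρ (y, s)} :=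
    isClosed_le continuous_const (by fun_prop)
  refine (dense_compl_singleton (0 : E)).induction (fun y hy => ?_) hclosed y
  have hy0 : y ≠ 0 := hy
  have hd := hρ.hasDerivAt_balancedHeight hn hy0
  exact mul_sub_le_image_sub_of_le_deriv (fun t => (hd t).differentiableAt)
    (fun t => by
      rw [(hd t).deriv]
      exact hcle _ fun h => hy0 (congrArg Prod.fst h)) hst

/-- The map `(y, t) ↦ (y, balancedHeight (y, t))`. -/
def verticalMap [Nontrivial E] (hρ : IsGauge ρ) (hn : n ≠ 0) : HomogBiLip (E × ℝ) :=
  HomogBiLip.shear (balancedHeight n ρ) (hρ.balancedHeight_lipschitz hn)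
    (hρ.balancedHeight_smul hn) (hρ.exists_balancedHeight_mono hn)

/-- The sum of the inverse `n`-th powers of the two radii is constant along vertical lines. -/
theorem IsGauge.inv_pow_add_inv_pow (hρ : IsGauge ρ) (hn : n ≠ 0) {y : E} (hy : y ≠ 0)
    (t : ℝ) : (tailRadius n ρ (y, t) ^ n)⁻¹ + (lowerRadius n ρ (y, t) ^ n)⁻¹ =
      (tailRadius n ρ (y, 0) ^ n)⁻¹ + (lowerRadius n ρ (y, 0) ^ n)⁻¹ := by
  have hd : ∀ t, HasDerivAt (fun t => (tailRadius n ρ (y, t) ^ n)⁻¹ +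
      (lowerRadius n ρ (y, t) ^ n)⁻¹) 0 t := by
    intro t
    have h1 := (hρ.hasDerivAt_tailIntegral hn hy t).const_mul (n : ℝ)
    have h2 := ((hρ.reflect.hasDerivAt_tailIntegral hn hy (-t)).comp t
      (hasDerivAt_neg t)).const_mul (n : ℝ)
    have h3 := h1.add h2
    have heq : (fun t => (tailRadius n ρ (y, t) ^ n)⁻¹ + (lowerRadius n ρ (y, t) ^ n)⁻¹) =
        fun t => (n * tailIntegral n ρ (y, t)) +
          n * tailIntegral n (fun z => ρ (verticalReflection E z)) (y, -t) := by
      ext t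
      rw [lowerRadius, hρ.tailRadius_pow hn (apexDist_pos hy),
        hρ.reflect.tailRadius_pow hn (apexDist_pos hy), inv_inv, inv_inv]
      rfl
    rw [heq]
    refine h3.congr_deriv ?_
    rw [verticalReflection_apply, neg_neg]
    ring
  exact is_const_of_deriv_eq_zero (fun t => (hd t).differentiableAt) (fun t => (hd t).deriv) t 0

/-- The function on `E` whose inverse `n`-th power is `n` times the integral of `ρ ^ (-(n+1))`
over vertical lines. -/
def fiberRadius (n : ℕ) (ρ : E × ℝ → ℝ) (y : E) : ℝ :=
  (((tailRadius n ρ (y, 0) ^ n)⁻¹ + (lowerRadius n ρ (y, 0) ^ n)⁻¹)⁻¹) ^ ((n : ℝ)⁻¹)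

theorem IsGauge.fiberRadius_pow (hρ : IsGauge ρ) (hn : n ≠ 0) (y : E) :
    fiberRadius n ρ y ^ n =
      ((tailRadius n ρ (y, 0) ^ n)⁻¹ + (lowerRadius n ρ (y, 0) ^ n)⁻¹)⁻¹ := by
  have h1 := tailRadius_nonneg (n := n) hρ (y, 0)
  have h2 := hρ.lowerRadius_nonneg (n := n) (y, 0)
  rw [fiberRadius, Real.rpow_inv_natCast_pow (by positivity) hn]

theorem IsGauge.inv_pow_add_inv_pow_eq (hρ : IsGauge ρ) (hn : n ≠ 0) {y : E} (hy : y ≠ 0)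
    (t : ℝ) : (tailRadius n ρ (y, t) ^ n)⁻¹ + (lowerRadius n ρ (y, t) ^ n)⁻¹ =
      (fiberRadius n ρ y ^ n)⁻¹ := by
  rw [hρ.inv_pow_add_inv_pow hn hy, hρ.fiberRadius_pow hn, inv_inv]

theorem IsGauge.fiberRadius_nonneg (hρ : IsGauge ρ) (y : E) : 0 ≤ fiberRadius n ρ y := by
  have h1 := tailRadius_nonneg (n := n) hρ (y, 0)
  have h2 := hρ.lowerRadius_nonneg (n := n) (y, 0)
  exact Real.rpow_nonneg (by positivity) _

theorem IsGauge.fiberRadius_pos (hρ : IsGauge ρ) (hn : n ≠ 0) {y : E} (hy : y ≠ 0) :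
    0 < fiberRadius n ρ y := by
  have h1 := hρ.tailRadius_pos hn (x := (y, 0)) (apexDist_pos hy)
  have h2 := hρ.lowerRadius_pos hn (x := (y, 0)) hy
  exact Real.rpow_pos_of_pos (by positivity) _

theorem fiberRadius_zero (hρ : IsGauge ρ) (hn : n ≠ 0) : fiberRadius n ρ (0 : E) = 0 := by
  have h1 : tailRadius n ρ ((0 : E), (0 : ℝ)) = 0 := by simp [tailRadius, apexDist]
  have h2 : lowerRadius n ρ ((0 : E), (0 : ℝ)) = 0 := by
    simp [lowerRadius, verticalReflection_apply, tailRadius, apexDist]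
  refine pow_eq_zero_iff hn |>.1 ?_
  -- The convention `0⁻¹ = 0` gives the correct value here.
  rw [hρ.fiberRadius_pow hn, h1, h2]
  simp [hn]

theorem IsGauge.fiberRadius_le_tail (hρ : IsGauge ρ) (hn : n ≠ 0) {y : E} (hy : y ≠ 0) :
    fiberRadius n ρ y ≤ tailRadius n ρ (y, 0) := by
  have h1 := hρ.tailRadius_pos hn (x := (y, 0)) (apexDist_pos hy)
  have h2 := hρ.lowerRadius_pos hn (x := (y, 0)) hy
  refine le_of_pow_le_pow_left₀ hn h1.le ?_
  rw [hρ.fiberRadius_pow hn]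
  refine inv_le_of_inv_le₀ (by positivity) ?_
  have : 0 < (lowerRadius n ρ (y, 0) ^ n)⁻¹ := by positivity
  linarith

theorem IsGauge.fiberRadius_le_lower (hρ : IsGauge ρ) (hn : n ≠ 0) {y : E} (hy : y ≠ 0) :
    fiberRadius n ρ y ≤ lowerRadius n ρ (y, 0) := by
  have h1 := hρ.tailRadius_pos hn (x := (y, 0)) (apexDist_pos hy)
  have h2 := hρ.lowerRadius_pos hn (x := (y, 0)) hy
  refine le_of_pow_le_pow_left₀ hn h2.le ?_
  rw [hρ.fiberRadius_pow hn]
  refine inv_le_of_inv_le₀ (by positivity) ?_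
  have : 0 < (tailRadius n ρ (y, 0) ^ n)⁻¹ := by positivity
  linarith

/-- For the Lipschitz bound: f is at most each of the two radii, so adding δ to a radius multiplies
it by at most 1 + δ / f. The combination of the radii has degree one, hence grows to at most (1 + δ
/ f) f = f + δ. -/
theorem IsGauge.isGauge_fiberRadius (hρ : IsGauge ρ) (hn : n ≠ 0) : IsGauge (fiberRadius n ρ) where
  pos y hy := hρ.fiberRadius_pos hn hy
  smul r hr y := by
    have he : ((r • y, 0) : E × ℝ) = r • (y, 0) := by simp
    refine (pow_left_inj₀ (hρ.fiberRadius_nonneg _)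
      (mul_nonneg hr (hρ.fiberRadius_nonneg _)) hn).1 ?_
    rw [mul_pow, hρ.fiberRadius_pow hn, hρ.fiberRadius_pow hn, he, hρ.tailRadius_smul hn hr,
      hρ.lowerRadius_smul hn hr, mul_pow, mul_pow, mul_inv, mul_inv, ← mul_add, mul_inv, inv_inv]
  lip := by
    obtain ⟨K, hK⟩ := hρ.tailRadius_lipschitz hn
    obtain ⟨L, hL⟩ := hρ.lowerRadius_lipschitz hn
    set M : ℝ := K + L
    have hM : 0 ≤ M := by positivity
    have hdist : ∀ y y' : E, dist ((y, 0) : E × ℝ) (y', 0) = dist y y' := fun y y' => by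
      rw [Prod.dist_eq, dist_self, max_eq_left dist_nonneg]
    have key : ∀ y y', fiberRadius n ρ y' ≤ fiberRadius n ρ y + M * dist y' y := by
      intro y y'
      set δ := M * dist y' y
      have hδ : 0 ≤ δ := by positivity
      by_cases hy' : y' = 0
      · rw [hy', fiberRadius_zero hρ hn]
        exact add_nonneg (hρ.fiberRadius_nonneg y) hδ
      have hKd : tailRadius n ρ (y', 0) ≤ tailRadius n ρ (y, 0) + δ := by
        have h := hK.dist_le_mul (y', 0) (y, 0)
        rw [hdist, Real.dist_eq] at h
        have h2 := le_abs_self (tailRadius n ρ (y', 0) - tailRadius n ρ (y, 0))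
        have h3 : K * dist y' y ≤ δ := by
          simp only [δ, M]
          gcongr
          linarith [L.2]
        linarith
      have hLd : lowerRadius n ρ (y', 0) ≤ lowerRadius n ρ (y, 0) + δ := by
        have h := hL.dist_le_mul (y', 0) (y, 0)
        rw [hdist, Real.dist_eq] at h
        have h2 := le_abs_self (lowerRadius n ρ (y', 0) - lowerRadius n ρ (y, 0))
        have h3 : L * dist y' y ≤ δ := by
          simp only [δ, M]
          gcongr
          linarith [K.2]
        linarith
      by_cases hy : y = 0
      · have h0 : tailRadius n ρ ((0 : E), (0 : ℝ)) = 0 := by simp [tailRadius, apexDist]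
        have := hρ.fiberRadius_le_tail hn hy'
        rw [hy, h0] at hKd
        rw [hy, fiberRadius_zero hρ hn]
        linarith
      have hf := hρ.fiberRadius_pos hn hy
      set f := fiberRadius n ρ y
      have hz : 0 ≤ δ / f := by positivity
      have h1 := hρ.tailRadius_pos hn (x := (y, 0)) (apexDist_pos hy)
      have h2 := hρ.lowerRadius_pos hn (x := (y, 0)) hy
      have h1' := hρ.tailRadius_pos hn (x := (y', 0)) (apexDist_pos hy')
      have h2' := hρ.lowerRadius_pos hn (x := (y', 0)) hy'
      have e1 : δ ≤ δ / f * tailRadius n ρ (y, 0) := by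
        rw [div_mul_eq_mul_div, le_div_iff₀ hf]
        gcongr
        exact hρ.fiberRadius_le_tail hn hy
      have e2 : δ ≤ δ / f * lowerRadius n ρ (y, 0) := by
        rw [div_mul_eq_mul_div, le_div_iff₀ hf]
        gcongr
        exact hρ.fiberRadius_le_lower hn hy
      have hstep : fiberRadius n ρ y' ≤ (1 + δ / f) * f := by
        refine le_of_pow_le_pow_left₀ hn (by positivity) ?_
        rw [mul_pow, hρ.fiberRadius_pow hn, hρ.fiberRadius_pow hn]
        calc ((tailRadius n ρ (y', 0) ^ n)⁻¹ + (lowerRadius n ρ (y', 0) ^ n)⁻¹)⁻¹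
            ≤ ((((1 + δ / f) * tailRadius n ρ (y, 0)) ^ n)⁻¹ +
              (((1 + δ / f) * lowerRadius n ρ (y, 0)) ^ n)⁻¹)⁻¹ := by
              gcongr <;> linarith
          _ = _ := by
              rw [mul_pow, mul_pow, mul_inv, mul_inv, ← mul_add, mul_inv, inv_inv]
      calc fiberRadius n ρ y' ≤ (1 + δ / f) * f := hstep
        _ = f + δ := by field_simp
    refine ⟨M.toNNReal, LipschitzWith.of_dist_le_mul fun x y => ?_⟩
    rw [Real.coe_toNNReal _ hM, Real.dist_eq, abs_sub_le_iff]
    have h1 := key x y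
    have h2 := key y x
    rw [dist_comm] at h1
    constructor <;> linarith

end Vertical

/-! ### From E to E × ℝ -/

section InductionStep

variable {E : Type*} [NormedAddCommGroup E] [NormedSpace ℝ E] [FiniteDimensional ℝ E]
  [MeasureSpace E] [BorelSpace E] [(volume : Measure E).IsAddHaarMeasure]

instance volume_prod_isAddHaarMeasure : (volume : Measure (E × ℝ)).IsAddHaarMeasure :=
  Measure.prod.instIsAddHaarMeasure volume volume

theorem ae_fst {p : E → Prop} (hp : ∀ᵐ y, p y) : ∀ᵐ x : E × ℝ, p x.1 :=
  Measure.quasiMeasurePreserving_fst.ae hp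

/-- The product of a map of `E` with the identity of `ℝ`. -/
def HomogBiLip.prodId (S : HomogBiLip E) : HomogBiLip (E × ℝ) where
  toEquiv := S.toEquiv.prodCongr (Equiv.refl ℝ)
  lip := by
    obtain ⟨K, hK⟩ := S.lip
    exact ⟨_, (hK.comp LipschitzWith.prod_fst).prodMk LipschitzWith.prod_snd⟩
  lip_symm := by
    obtain ⟨K, hK⟩ := S.lip_symm
    exact ⟨_, (hK.comp LipschitzWith.prod_fst).prodMk LipschitzWith.prod_snd⟩
  map_smul' r hr x := Prod.ext (S.map_smul hr x.1) rfl

theorem HomogBiLip.hasDet_prodId {S : HomogBiLip E} {f : E → ℝ} (hS : HasDet S f) :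
    HasDet S.prodId (fun x => f x.1) := by
  filter_upwards [ae_fst hS] with x ⟨D, hD, hDf⟩
  refine ⟨D.prodMap (ContinuousLinearMap.id ℝ ℝ), hD.prodMap x (hasFDerivAt_id x.2), ?_⟩
  rw [← hDf]
  have := LinearMap.det_prodMap (D : E →ₗ[ℝ] E) (LinearMap.id : ℝ →ₗ[ℝ] ℝ)
  rw [LinearMap.det_id, mul_one] at this
  exact this

variable [Nontrivial E] {n : ℕ} {ρ : E × ℝ → ℝ}

/-- The derivative fixes the E-component, so it is a transvection in the direction (0, 1) and its
determinant is the vertical derivative of the height. -/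
theorem hasDet_verticalMap (hρ : IsGauge ρ) (hn : n ≠ 0) :
    HasDet (verticalMap hρ hn) (heightRate n ρ) := by
  obtain ⟨K, hK⟩ := hρ.balancedHeight_lipschitz hn
  filter_upwards [hK.ae_differentiableAt (μ := volume), ae_fst (ae_ne_zero (E := E))] with x hx hy
  obtain ⟨y, t⟩ := x
  set D := fderiv ℝ (balancedHeight n ρ) (y, t)
  have hD : HasFDerivAt (balancedHeight n ρ) D (y, t) := hx.hasFDerivAt
  have hD1 : D (0, 1) = heightRate n ρ (y, t) := by
    have h1 : HasDerivAt (fun s : ℝ => (y, s)) ((0 : E), (1 : ℝ)) t :=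
      (hasDerivAt_const t y).prodMk (hasDerivAt_id t)
    exact (hD.comp_hasDerivAt t h1).unique (hρ.hasDerivAt_balancedHeight hn hy t)
  refine ⟨(ContinuousLinearMap.fst ℝ E ℝ).prod D, hasFDerivAt_fst.prodMk hD, ?_⟩
  have : (((ContinuousLinearMap.fst ℝ E ℝ).prod D : E × ℝ →L[ℝ] E × ℝ) : E × ℝ →ₗ[ℝ] E × ℝ) =
      LinearMap.transvection ((D : E × ℝ →ₗ[ℝ] ℝ) - LinearMap.snd ℝ E ℝ) (0, 1) := by
    refine LinearMap.ext fun z => ?_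
    simp [LinearMap.transvection, Prod.ext_iff]
  rw [ContinuousLinearMap.det, this, LinearMap.transvection.det]
  simp [hD1]

/-- With a fixed difference both numbers move in the same direction, while the sum of inverse powers
is strictly decreasing. On a given fiber the height thus determines both radii. -/
theorem eq_of_sub_eq_of_inv_pow_add {n : ℕ} {a b a' b' : ℝ} (ha : 0 < a) (hb : 0 < b)
    (ha' : 0 < a') (hb' : 0 < b') (hn : n ≠ 0) (hsub : a - b = a' - b')
    (hsum : (a ^ n)⁻¹ + (b ^ n)⁻¹ = (a' ^ n)⁻¹ + (b' ^ n)⁻¹) : a = a' ∧ b = b' := by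
  have key : ∀ {a b a' b' : ℝ}, 0 < a → 0 < b → a < a' → b < b' →
      (a' ^ n)⁻¹ + (b' ^ n)⁻¹ < (a ^ n)⁻¹ + (b ^ n)⁻¹ := by
    intro a b a' b' ha hb h1 h2
    have e1 := pow_lt_pow_left₀ h1 ha.le hn
    have e2 := pow_lt_pow_left₀ h2 hb.le hn
    gcongr
  rcases lt_trichotomy a a' with h | h | h
  · exact absurd hsum (key ha hb h (by linarith)).ne'
  · exact ⟨h, by linarith⟩
  · exact absurd hsum (key ha' hb' h (by linarith)).ne

/-- Gauges on `E × ℝ` are equivalent if their fiber radii are equivalent on `E`. -/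
theorem GaugeEquiv.of_fiberRadius {ρ' : E × ℝ → ℝ} (hρ : IsGauge ρ) (hρ' : IsGauge ρ')
    (hn : n = Module.finrank ℝ E)
    (h : GaugeEquiv (fiberRadius n ρ) (fiberRadius n ρ')) : GaugeEquiv ρ ρ' := by
  obtain ⟨S, hS, k, hk, hdet⟩ := h
  have hn0 : n ≠ 0 := by rw [hn]; exact Module.finrank_pos.ne'
  set V := verticalMap hρ hn0
  set V' := verticalMap hρ' hn0
  obtain ⟨c', hc', hrate'⟩ := hρ'.exists_le_heightRate hn0
  have hV' : HasDet V'.symm (fun x => (heightRate n ρ' (V'.symm x))⁻¹) :=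
    HomogBiLip.hasDet_symm (hasDet_verticalMap hρ' hn0) (by
      filter_upwards [ae_ne_zero (E := E × ℝ)] with x hx
      exact (hc'.trans_le (hrate' x hx)).ne')
  have hdetT := HomogBiLip.hasDet_trans (hasDet_verticalMap hρ hn0)
    (HomogBiLip.hasDet_trans (HomogBiLip.hasDet_prodId hdet) hV')
  refine GaugeEquiv.of_density hρ hρ' (V.trans (S.prodId.trans V'.symm)) hk
    (HomogBiLip.hasDet_congr hdetT ?_)
  filter_upwards [ae_fst (ae_ne_zero (E := E))] with x hy
  simp only [HomogBiLip.trans_apply]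
  obtain ⟨y, t⟩ := x
  set x' := V'.symm (S.prodId (V (y, t))) with hx'
  have hVx : V' x' = (S y, balancedHeight n ρ (y, t)) := V'.apply_symm_apply _
  obtain ⟨y', t'⟩ := x'
  have h1 : y' = S y := congrArg Prod.fst hVx
  have h2 : balancedHeight n ρ' (y', t') = balancedHeight n ρ (y, t) := congrArg Prod.snd hVx
  have hy' : y' ≠ 0 := by rw [h1]; exact fun h => hy (S.map_eq_zero.1 h)
  -- S preserves the fiber radius, so the total masses of the two lines agree; the heights agree by
  -- construction.
  have hsum : (tailRadius n ρ (y, t) ^ n)⁻¹ + (lowerRadius n ρ (y, t) ^ n)⁻¹ =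
      (tailRadius n ρ' (y', t') ^ n)⁻¹ + (lowerRadius n ρ' (y', t') ^ n)⁻¹ := by
    rw [hρ.inv_pow_add_inv_pow_eq hn0 hy, hρ'.inv_pow_add_inv_pow_eq hn0 hy', h1, hS]
  have hU := hρ.tailRadius_pos hn0 (x := (y, t)) (apexDist_pos hy)
  have hL := hρ.lowerRadius_pos hn0 (x := (y, t)) hy
  obtain ⟨e1, e2⟩ := eq_of_sub_eq_of_inv_pow_add hU hL
    (hρ'.tailRadius_pos hn0 (x := (y', t')) (apexDist_pos hy'))
    (hρ'.lowerRadius_pos hn0 (x := (y', t')) hy') hn0 h2.symm hsum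
  have hr : 0 < ρ (y, t) := hρ.pos _ fun h => hy (congrArg Prod.fst h)
  have hr' : 0 < ρ' (y', t') := hρ'.pos _ fun h => hy' (congrArg Prod.fst h)
  have hfin : Module.finrank ℝ (E × ℝ) = n + 1 := by
    rw [Module.finrank_prod, Module.finrank_self, hn]
  rw [hfin]
  change (heightRate n ρ' (y', t'))⁻¹ * k * heightRate n ρ (y, t) =
    k * (ρ' (y', t') / ρ (y, t)) ^ (n + 1)
  -- The two rates now have the same numerator; only the powers of ρ and ρ' survive.
  rw [heightRate, heightRate, ← e1, ← e2, div_pow]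
  field_simp

/-- All gauges on `E` are equivalent. -/
def AllGaugesEquiv (E : Type*) [NormedAddCommGroup E] [NormedSpace ℝ E] [MeasureSpace E] : Prop :=
  ∀ ρ σ : E → ℝ, IsGauge ρ → IsGauge σ → GaugeEquiv ρ σ

theorem AllGaugesEquiv.prod_real (h : AllGaugesEquiv E) : AllGaugesEquiv (E × ℝ) := by
  intro ρ σ hρ hσ
  have hn : Module.finrank ℝ E ≠ 0 := Module.finrank_pos.ne'
  exact GaugeEquiv.of_fiberRadius hρ hσ rfl
    (h _ _ (hρ.isGauge_fiberRadius hn) (hσ.isGauge_fiberRadius hn))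

end InductionStep

/-! ### Linear changes of coordinates -/

section Transport

variable {E F : Type*} [NormedAddCommGroup E] [NormedSpace ℝ E] [FiniteDimensional ℝ E]
  [MeasureSpace E] [BorelSpace E] [(volume : Measure E).IsAddHaarMeasure]
  [NormedAddCommGroup F] [NormedSpace ℝ F] [FiniteDimensional ℝ F]
  [MeasureSpace F] [BorelSpace F] [(volume : Measure F).IsAddHaarMeasure]

/-- Conjugation by a linear isomorphism. -/
def HomogBiLip.conj (T : HomogBiLip E) (L : E ≃L[ℝ] F) : HomogBiLip F where
  toEquiv := (L.symm.toEquiv.trans T.toEquiv).trans L.toEquiv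
  lip := by
    obtain ⟨K, hK⟩ := T.lip
    exact ⟨_, L.lipschitz.comp (hK.comp L.symm.lipschitz)⟩
  lip_symm := by
    obtain ⟨K, hK⟩ := T.lip_symm
    exact ⟨_, L.lipschitz.comp (hK.comp L.symm.lipschitz)⟩
  map_smul' r hr x := by
    change L (T (L.symm (r • x))) = r • L (T (L.symm x))
    rw [L.symm.map_smul, T.map_smul hr, L.map_smul]

theorem AllGaugesEquiv.of_equiv (h : AllGaugesEquiv E) (L : E ≃L[ℝ] F) : AllGaugesEquiv F := by
  intro ρ σ hρ hσ
  obtain ⟨T, hT, k, hk, hdet⟩ := h _ _ (hρ.comp_linear L) (hσ.comp_linear L)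
  refine ⟨T.conj L, fun x => ?_, k, hk, ?_⟩
  · exact (hT (L.symm x)).trans (congrArg ρ (L.apply_symm_apply x))
  · have hq : Measure.QuasiMeasurePreserving L.symm (volume : Measure F) (volume : Measure E) :=
      ⟨L.symm.continuous.measurable, Measure.absolutelyContinuous_isAddHaarMeasure _ _⟩
    filter_upwards [hq.ae hdet] with x ⟨D, hD, hDk⟩
    refine ⟨(L : E →L[ℝ] F).comp (D.comp (L.symm : F →L[ℝ] E)),
      L.hasFDerivAt.comp x (hD.comp x L.symm.hasFDerivAt), ?_⟩
    rw [← hDk]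
    exact LinearMap.det_conj (D : E →ₗ[ℝ] E) L.toLinearEquiv

end Transport

/-! ### The planar base case and the induction -/

section Plane

theorem IsGauge.real_apply {σ : ℝ → ℝ} (hσ : IsGauge σ) (h : σ 1 = σ (-1)) (y : ℝ) :
    σ y = |y| * σ 1 := by
  rcases le_total 0 y with hy | hy
  · have := hσ.smul y hy 1
    rw [smul_eq_mul, mul_one] at this
    rw [this, abs_of_nonneg hy]
  · have := hσ.smul (-y) (by linarith) (-1)
    rw [smul_eq_mul, neg_mul_neg, mul_one] at this
    rw [this, abs_of_nonpos hy, h]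

/-- Even gauges on the line are multiples of |y|, so a scaling does it. Evenness cannot simply be
dropped: the ratio of the values at 1 and -1 is an invariant of the equivalence. -/
theorem GaugeEquiv.real_of_even {σ τ : ℝ → ℝ} (hσ : IsGauge σ) (hτ : IsGauge τ)
    (h : σ 1 = σ (-1)) (h' : τ 1 = τ (-1)) : GaugeEquiv σ τ := by
  have h1 := hσ.pos 1 one_ne_zero
  have h2 := hτ.pos 1 one_ne_zero
  have hc : 0 < σ 1 / τ 1 := div_pos h1 h2
  set L : ℝ ≃L[ℝ] ℝ := ContinuousLinearEquiv.unitsEquivAut ℝ (Units.mk0 _ hc.ne')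
  have hL : ∀ y, L y = y * (σ 1 / τ 1) := fun y => rfl
  have := GaugeEquiv.of_linear τ L (by
    rw [ContinuousLinearMap.det, LinearMap.det_ring]
    change 0 < L 1
    rw [hL, one_mul]
    exact hc)
  convert this using 2 with y
  rw [hσ.real_apply h, hτ.real_apply h', hL, abs_mul, abs_of_pos hc]
  field_simp

/-- Rotation of the plane. -/
def planeRotation (α : ℝ) : (ℝ × ℝ) ≃L[ℝ] (ℝ × ℝ) :=
  let f : ℝ → (ℝ × ℝ) →L[ℝ] (ℝ × ℝ) := fun β =>
    (Real.cos β • ContinuousLinearMap.fst ℝ ℝ ℝ - Real.sin β • ContinuousLinearMap.snd ℝ ℝ ℝ).prod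
    (Real.sin β • ContinuousLinearMap.fst ℝ ℝ ℝ + Real.cos β • ContinuousLinearMap.snd ℝ ℝ ℝ)
  ContinuousLinearEquiv.equivOfInverse (f α) (f (-α))
    (fun z => by
      ext <;> simp [f]
      · linear_combination z.1 * Real.sin_sq_add_cos_sq α
      · linear_combination z.2 * Real.sin_sq_add_cos_sq α)
    (fun z => by
      ext <;> simp [f]
      · linear_combination z.1 * Real.sin_sq_add_cos_sq α
      · linear_combination z.2 * Real.sin_sq_add_cos_sq α)

theorem planeRotation_apply (α : ℝ) (z : ℝ × ℝ) : planeRotation α z =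
    (Real.cos α * z.1 - Real.sin α * z.2, Real.sin α * z.1 + Real.cos α * z.2) := rfl

theorem planeRotation_det (α : ℝ) : (planeRotation α : (ℝ × ℝ) →L[ℝ] (ℝ × ℝ)).det = 1 := by
  have : ((planeRotation α : (ℝ × ℝ) →L[ℝ] (ℝ × ℝ)) : (ℝ × ℝ) →ₗ[ℝ] (ℝ × ℝ)) =
      Matrix.toLin (.finTwoProd ℝ) (.finTwoProd ℝ)
        !![Real.cos α, -Real.sin α; Real.sin α, Real.cos α] := by
    refine LinearMap.ext fun z => ?_
    rw [Matrix.toLin_finTwoProd_apply]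
    change planeRotation α z = _
    rw [planeRotation_apply, neg_mul, sub_eq_add_neg]
  rw [ContinuousLinearMap.det, this, LinearMap.det_toLin, Matrix.det_fin_two_of]
  linear_combination Real.sin_sq_add_cos_sq α

theorem norm_le_planeRotation (α : ℝ) (z : ℝ × ℝ) : ‖z‖ ≤ 2 * ‖planeRotation α z‖ := by
  set w := planeRotation α z with hw
  have hz1 : z.1 = Real.cos α * w.1 + Real.sin α * w.2 := by
    rw [hw, planeRotation_apply]
    linear_combination -z.1 * Real.sin_sq_add_cos_sq α
  have hz2 : z.2 = -Real.sin α * w.1 + Real.cos α * w.2 := by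
    rw [hw, planeRotation_apply]
    linear_combination -z.2 * Real.sin_sq_add_cos_sq α
  have hw1 : |w.1| ≤ ‖w‖ := norm_fst_le w
  have hw2 : |w.2| ≤ ‖w‖ := norm_snd_le w
  have hc := Real.abs_cos_le_one α
  have hs := Real.abs_sin_le_one α
  have e : ∀ a b : ℝ, |a| ≤ 1 → |b| ≤ ‖w‖ → |a * b| ≤ ‖w‖ := fun a b ha hb => by
    rw [abs_mul]
    exact (mul_le_of_le_one_left (abs_nonneg _) ha).trans hb
  rw [Prod.norm_def]
  refine max_le ?_ ?_
  · rw [hz1, Real.norm_eq_abs]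
    linarith [abs_add_le (Real.cos α * w.1) (Real.sin α * w.2), e _ _ hc hw1, e _ _ hs hw2]
  · rw [hz2, Real.norm_eq_abs]
    linarith [abs_add_le (-Real.sin α * w.1) (Real.cos α * w.2), e _ _ hc hw2,
      e (-Real.sin α) w.1 (by rwa [abs_neg]) hw1]

/-- Dominated convergence with a bound uniform in the angle. The constant c / 4 loses 2 from max(1,
s) ≥ (1 + s) / 2 and 2 because the sup norm is not rotation invariant. -/
theorem IsGauge.continuous_rotated_tail {ρ : ℝ × ℝ → ℝ} (hρ : IsGauge ρ) {a b : ℝ}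
    (ha : |a| = 1) (hb : |b| = 1) :
    Continuous fun α => ∫ s in Ioi (0 : ℝ), (ρ (planeRotation α (a, b * s)) ^ (1 + 1))⁻¹ := by
  obtain ⟨c, hc, hcle⟩ := hρ.exists_ge
  have hlow : ∀ α s : ℝ, 0 ≤ s → c / 4 * (1 + s) ≤ ρ (planeRotation α (a, b * s)) := by
    intro α s hs
    refine le_trans ?_ (hcle _)
    have h1 := norm_le_planeRotation α (a, b * s)
    have h2 : |a| ≤ ‖(a, b * s)‖ := norm_fst_le (a, b * s)
    have h3 : |b * s| ≤ ‖(a, b * s)‖ := norm_snd_le (a, b * s)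
    rw [abs_mul, hb, one_mul, abs_of_nonneg hs] at h3
    rw [ha] at h2
    nlinarith
  have hpos : ∀ α s : ℝ, 0 ≤ s → 0 < ρ (planeRotation α (a, b * s)) := fun α s hs =>
    lt_of_lt_of_le (by positivity) (hlow α s hs)
  refine continuous_of_dominated
    (bound := fun s => ((c / 4) ^ (1 + 1))⁻¹ * ((1 + s) ^ (1 + 1))⁻¹) ?_ ?_ ?_ ?_
  · intro α
    have : Continuous fun s : ℝ => ρ (planeRotation α (a, b * s)) :=
      hρ.continuous.comp ((planeRotation α).continuous.comp (by fun_prop))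
    exact (this.measurable.pow_const _).inv.aestronglyMeasurable
  · intro α
    refine (ae_restrict_iff' measurableSet_Ioi).2 (ae_of_all _ fun s hs => ?_)
    have hs0 : (0 : ℝ) < s := hs
    have := hlow α s hs0.le
    have h0 := hpos α s hs0.le
    rw [Real.norm_of_nonneg (by positivity), ← mul_inv, ← mul_pow]
    gcongr
  · exact (integrableOn_inv_pow_add one_ne_zero one_pos).1.const_mul _
  · refine (ae_restrict_iff' measurableSet_Ioi).2 (ae_of_all _ fun s hs => ?_)
    have hs0 : (0 : ℝ) < s := hs
    have : Continuous fun α : ℝ => ρ (planeRotation α (a, b * s)) := by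
      simp only [planeRotation_apply]
      exact hρ.continuous.comp (by fun_prop)
    exact (this.pow _).inv₀ fun α => (pow_pos (hpos α s hs0.le) _).ne'

theorem IsGauge.fiberRadius_one_inv {ρ : ℝ × ℝ → ℝ} (hρ : IsGauge ρ) {y : ℝ} (hy : y ≠ 0) :
    (fiberRadius 1 ρ y)⁻¹ = (∫ s in Ioi (0 : ℝ), (ρ (y, 1 * s) ^ (1 + 1))⁻¹) +
      ∫ s in Ioi (0 : ℝ), (ρ (y, -1 * s) ^ (1 + 1))⁻¹ := by
  have h := hρ.inv_pow_add_inv_pow_eq one_ne_zero hy 0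
  rw [lowerRadius, hρ.tailRadius_pow one_ne_zero (apexDist_pos hy),
    hρ.reflect.tailRadius_pow one_ne_zero (apexDist_pos hy), inv_inv, inv_inv, pow_one] at h
  rw [← h]
  simp [tailIntegral, verticalReflection_apply]

/-- Some rotation balances the masses of the two half planes. -/
theorem IsGauge.exists_balanced_rotation {ρ : ℝ × ℝ → ℝ} (hρ : IsGauge ρ) :
    ∃ α, fiberRadius 1 (fun z => ρ (planeRotation α z)) 1 =
      fiberRadius 1 (fun z => ρ (planeRotation α z)) (-1) := by
  set J : ℝ → ℝ → ℝ → ℝ := fun a b α =>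
    ∫ s in Ioi (0 : ℝ), (ρ (planeRotation α (a, b * s)) ^ (1 + 1))⁻¹
  have hJ : ∀ a b : ℝ, |a| = 1 → |b| = 1 → Continuous (J a b) := fun a b ha hb =>
    hρ.continuous_rotated_tail ha hb
  have hpi : ∀ a b : ℝ, J a b Real.pi = J (-a) (-b) 0 := fun a b => by
    simp only [J]
    congr 1
    ext s
    simp [planeRotation_apply]
  set g : ℝ → ℝ := fun α => (J 1 1 α + J 1 (-1) α) - (J (-1) 1 α + J (-1) (-1) α)
  have hg : Continuous g :=
    ((hJ 1 1 (by simp) (by simp)).add (hJ 1 (-1) (by simp) (by simp))).sub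
      ((hJ (-1) 1 (by simp) (by simp)).add (hJ (-1) (-1) (by simp) (by simp)))
  -- A half turn exchanges the two half planes, so the mass difference g changes sign and vanishes
  -- at some angle.
  have hgpi : g Real.pi = - g 0 := by
    simp only [g, hpi, neg_neg]
    ring
  have hz : ∃ α, g α = 0 := by
    rcases le_total (g 0) 0 with h0 | h0
    · exact mem_range_of_exists_le_of_exists_ge hg ⟨0, h0⟩ ⟨Real.pi, by rw [hgpi]; linarith⟩
    · exact mem_range_of_exists_le_of_exists_ge hg ⟨Real.pi, by rw [hgpi]; linarith⟩ ⟨0, h0⟩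
  obtain ⟨α, hα⟩ := hz
  have hρα := hρ.comp_linear (planeRotation α)
  refine ⟨α, inv_injective ?_⟩
  rw [hρα.fiberRadius_one_inv one_ne_zero, hρα.fiberRadius_one_inv (by norm_num)]
  exact sub_eq_zero.1 hα

theorem allGaugesEquiv_plane : AllGaugesEquiv (ℝ × ℝ) := by
  have red : ∀ ρ : ℝ × ℝ → ℝ, IsGauge ρ → ∃ ρ' : ℝ × ℝ → ℝ, IsGauge ρ' ∧ GaugeEquiv ρ' ρ ∧
      fiberRadius 1 ρ' 1 = fiberRadius 1 ρ' (-1) := by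
    intro ρ hρ
    obtain ⟨α, hα⟩ := hρ.exists_balanced_rotation
    exact ⟨_, hρ.comp_linear _, GaugeEquiv.of_linear ρ (planeRotation α)
      (by rw [planeRotation_det]; exact one_pos), hα⟩
  intro ρ σ hρ hσ
  obtain ⟨ρ', hρ', e1, h1⟩ := red ρ hρ
  obtain ⟨σ', hσ', e2, h2⟩ := red σ hσ
  exact (e1.symm.trans (GaugeEquiv.of_fiberRadius hρ' hσ' (by simp)
    (GaugeEquiv.real_of_even (hρ'.isGauge_fiberRadius one_ne_zero)
      (hσ'.isGauge_fiberRadius one_ne_zero) h1 h2))).trans e2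

theorem allGaugesEquiv_euc {d : ℕ} (hd : 2 ≤ d) : AllGaugesEquiv (Euc d) := by
  induction d, hd using Nat.le_induction with
  | base =>
    exact allGaugesEquiv_plane.of_equiv (ContinuousLinearEquiv.ofFinrankEq (by simp))
  | succ d hd ih =>
    have : Nontrivial (Euc d) := by
      have : Nonempty (Fin d) := ⟨⟨0, by omega⟩⟩
      infer_instance
    exact ih.prod_real.of_equiv (ContinuousLinearEquiv.ofFinrankEq (by simp))

end Plane

/-! ### Volumes of images -/

section AreaFormula

variable {E : Type*} [NormedAddCommGroup E] [NormedSpace ℝ E] [FiniteDimensional ℝ E]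
  [MeasureSpace E] [BorelSpace E] [(volume : Measure E).IsAddHaarMeasure]

/-- The change of variables formula applies where T is differentiable with the given determinant;
the rest is null and has null image because T is Lipschitz. -/
theorem HomogBiLip.volume_image (T : HomogBiLip E) {f : E → ℝ} (hT : HasDet T f) {A : Set E}
    (hA : MeasurableSet A) : volume (T '' A) = ∫⁻ x in A, ENNReal.ofReal |f x| := by
  set B : Set E := {x | ∃ D : E →L[ℝ] E, HasFDerivAt T D x ∧ D.det = f x} with hB
  have hBae : B ∈ ae (volume : Measure E) := hT
  have hBn : volume Bᶜ = 0 := mem_ae_iff.1 hBae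
  have hAB : (A ∩ B : Set E) =ᵐ[volume] A := by
    filter_upwards [hBae] with x hx
    exact propext (and_iff_left hx)
  have hder : ∀ x ∈ A ∩ B, HasFDerivAt T (fderiv ℝ T x) x ∧ (fderiv ℝ T x).det = f x := by
    rintro x ⟨-, D, hD, hDf⟩
    rw [hD.fderiv]
    exact ⟨hD, hDf⟩
  have h1 := lintegral_abs_det_fderiv_eq_addHaar_image₀ (volume : Measure E)
    (s := A ∩ B) (f := T) (f' := fderiv ℝ T) (hA.nullMeasurableSet.congr hAB.symm)
    (fun x hx => (hder x hx).1.hasFDerivWithinAt) T.injective.injOn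
  have h2 : volume (T '' A) = volume (T '' (A ∩ B)) := by
    refine le_antisymm ?_ (measure_mono (image_mono inter_subset_left))
    obtain ⟨K, hK⟩ := T.lipschitz
    have : T '' A ⊆ T '' (A ∩ B) ∪ T '' Bᶜ := by
      rw [← image_union]
      refine image_mono fun x hx => ?_
      by_cases hxB : x ∈ B
      · exact Or.inl ⟨hx, hxB⟩
      · exact Or.inr hxB
    refine (measure_mono this).trans ((measure_union_le _ _).trans ?_)
    rw [LipschitzWith.volume_image_eq_zero hK hBn, add_zero]
  rw [h2, ← h1, Measure.restrict_congr_set hAB]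
  refine lintegral_congr_ae ?_
  filter_upwards [ae_restrict_mem hA, ae_restrict_of_ae hBae] with x hxA hxB
  rw [(hder x ⟨hxA, hxB⟩).2]

end AreaFormula

/-! ### The star gauge, polar coordinates and sphere Jacobians -/

section Sphere

variable {d : ℕ}

theorem USphere.ne_zero (ξ : USphere d) : (ξ : Euc d) ≠ 0 := ne_zero_of_mem_unit_sphere ξ

theorem USphere.norm_eq (ξ : USphere d) : ‖(ξ : Euc d)‖ = 1 := norm_eq_of_mem_sphere ξ

theorem norm_smul_direction {x : Euc d} (hx : x ≠ 0) : ‖x‖ • (direction x hx : Euc d) = x := by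
  rw [direction, smul_smul, mul_inv_cancel₀ (norm_ne_zero_iff.2 hx), one_smul]

theorem direction_smul {r : ℝ} (hr : 0 < r) {x : Euc d} (hx : x ≠ 0) (hrx : r • x ≠ 0) :
    direction (r • x) hrx = direction x hx := by
  apply Subtype.ext
  simp only [direction]
  rw [norm_smul, Real.norm_of_nonneg hr.le, smul_smul]
  congr 1
  field_simp

theorem direction_coe (ξ : USphere d) : direction (ξ : Euc d) ξ.ne_zero = ξ := by
  apply Subtype.ext
  simp [direction]

open scoped Classical in
/-- The gauge of the starlike domain with radius function `R`. -/
def starGauge (R : USphere d → ℝ) (x : Euc d) : ℝ :=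
  if hx : x = 0 then 0 else ‖x‖ / R (direction x hx)

theorem starGauge_smul_coe (R : USphere d → ℝ) {r : ℝ} (hr : 0 ≤ r) (ξ : USphere d) :
    starGauge R (r • (ξ : Euc d)) = r / R ξ := by
  rcases hr.eq_or_lt with rfl | hr'
  · simp [starGauge]
  have hne : r • (ξ : Euc d) ≠ 0 := smul_ne_zero hr'.ne' ξ.ne_zero
  rw [starGauge, dif_neg hne, direction_smul hr' ξ.ne_zero, direction_coe, norm_smul,
    Real.norm_of_nonneg hr, ξ.norm_eq, mul_one]

theorem starGauge_coe (R : USphere d → ℝ) (ξ : USphere d) :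
    starGauge R (ξ : Euc d) = 1 / R ξ := by
  simpa using starGauge_smul_coe R zero_le_one ξ

theorem mem_starlikeDomain_iff {R : USphere d → ℝ} (hR : ∀ ξ, 0 < R ξ) (hd : 2 ≤ d) {x : Euc d} :
    x ∈ starlikeDomain R ↔ starGauge R x < 1 := by
  constructor
  · rintro ⟨ξ, r, hr, hrR, rfl⟩
    rw [starGauge_smul_coe R hr, div_lt_one (hR ξ)]
    exact hrR
  · intro h
    by_cases hx : x = 0
    · have : Nonempty (Fin d) := ⟨⟨0, by omega⟩⟩
      obtain ⟨z, hz⟩ := (NormedSpace.sphere_nonempty (x := (0 : Euc d)) (r := 1)).2 zero_le_one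
      exact ⟨⟨z, hz⟩, 0, le_rfl, hR _, by rw [hx, zero_smul]⟩
    · rw [starGauge, dif_neg hx, div_lt_one (hR _)] at h
      exact ⟨direction x hx, ‖x‖, norm_nonneg _, h, (norm_smul_direction hx).symm⟩

/-- With ξ, η the directions of x, y, one has ‖y‖ (ξ - η) = (‖y‖ - ‖x‖) ξ + (x - y). -/
theorem norm_mul_dist_direction_le {x y : Euc d} (hx : x ≠ 0) (hy : y ≠ 0) :
    ‖y‖ * dist (direction x hx) (direction y hy) ≤ 2 * ‖x - y‖ := by
  rw [Subtype.dist_eq, dist_eq_norm]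
  have h1 : ‖y‖ * ‖(direction x hx : Euc d) - direction y hy‖ =
      ‖(‖y‖ - ‖x‖) • (direction x hx : Euc d) + (x - y)‖ := by
    rw [← norm_norm y, ← norm_smul, norm_norm]
    congr 1
    rw [smul_sub, sub_smul, norm_smul_direction hx, norm_smul_direction hy]
    abel
  rw [h1]
  refine (norm_add_le _ _).trans ?_
  rw [norm_smul, USphere.norm_eq, mul_one, Real.norm_eq_abs]
  have := abs_norm_sub_norm_le y x
  rw [norm_sub_rev] at this
  linarith

theorem isGauge_starGauge {R : USphere d → ℝ} (hR : ∀ ξ, 0 < R ξ) (hL : ∃ L, LipschitzWith L R) :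
    IsGauge (starGauge R) where
  pos x hx := by
    rw [starGauge, dif_neg hx]
    exact div_pos (norm_pos_iff.2 hx) (hR _)
  smul r hr x := by
    rcases hr.eq_or_lt with rfl | hr'
    · simp [starGauge]
    by_cases hx : x = 0
    · simp [hx, starGauge]
    have hne : r • x ≠ 0 := smul_ne_zero hr'.ne' hx
    rw [starGauge, dif_neg hne, starGauge, dif_neg hx, direction_smul hr' hx, norm_smul,
      Real.norm_of_nonneg hr, mul_div_assoc]
  lip := by
    obtain ⟨L, hL⟩ := hL
    obtain ⟨m, hm, hmle⟩ : ∃ m, 0 < m ∧ ∀ ξ, m ≤ R ξ := by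
      rcases isEmpty_or_nonempty (USphere d) with h | h
      · exact ⟨1, one_pos, fun ξ => (h.false ξ).elim⟩
      · obtain ⟨z, -, hz⟩ := isCompact_univ.exists_isMinOn univ_nonempty
          hL.continuous.continuousOn
        exact ⟨R z, hR z, fun ξ => hz (mem_univ ξ)⟩
    set K : ℝ := 1 / m + 2 * L / (m * m) with hK
    have hK0 : 0 ≤ K := by positivity
    have hdiv : ∀ ξ, 1 / R ξ ≤ 1 / m := fun ξ => one_div_le_one_div_of_le hm (hmle ξ)
    have hsingle : ∀ x : Euc d, |starGauge R x| ≤ K * ‖x‖ := fun x => by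
      by_cases hx : x = 0
      · simp [hx, starGauge]
      rw [starGauge, dif_neg hx, abs_of_nonneg (div_nonneg (norm_nonneg _) (hR _).le),
        div_eq_mul_one_div, mul_comm]
      refine mul_le_mul_of_nonneg_right ((hdiv _).trans ?_) (norm_nonneg _)
      rw [hK]
      have : 0 ≤ 2 * L / (m * m) := by positivity
      linarith
    refine ⟨K.toNNReal, LipschitzWith.of_dist_le_mul fun x y => ?_⟩
    rw [Real.coe_toNNReal _ hK0, Real.dist_eq, dist_eq_norm]
    by_cases hx : x = 0
    · have := hsingle y
      simpa [hx, starGauge] using this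
    by_cases hy : y = 0
    · have := hsingle x
      simpa [hy, starGauge] using this
    rw [starGauge, dif_neg hx, starGauge, dif_neg hy]
    set ξ := direction x hx
    set η := direction y hy
    have hξ := hR ξ
    have hη := hR η
    have e : ‖x‖ / R ξ - ‖y‖ / R η =
        (‖x‖ - ‖y‖) * (1 / R ξ) + ‖y‖ * (R η - R ξ) / (R ξ * R η) := by
      field_simp
      ring
    rw [e]
    refine (abs_add_le _ _).trans ?_
    have h1 : |(‖x‖ - ‖y‖) * (1 / R ξ)| ≤ ‖x - y‖ * (1 / m) := by
      rw [abs_mul, abs_of_pos (by positivity : 0 < 1 / R ξ)]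
      exact mul_le_mul (abs_norm_sub_norm_le x y) (hdiv ξ) (by positivity) (norm_nonneg _)
    have h2 : |‖y‖ * (R η - R ξ) / (R ξ * R η)| ≤ 2 * L / (m * m) * ‖x - y‖ := by
      rw [abs_div, abs_mul, abs_norm, abs_of_pos (mul_pos hξ hη)]
      have h3 : |R η - R ξ| ≤ L * dist ξ η := by
        have := hL.dist_le_mul η ξ
        rwa [Real.dist_eq, dist_comm η] at this
      have h4 := norm_mul_dist_direction_le hx hy
      have h5 : ‖y‖ * |R η - R ξ| ≤ 2 * L * ‖x - y‖ := by
        calc ‖y‖ * |R η - R ξ| ≤ ‖y‖ * (L * dist ξ η) := by gcongr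
          _ = L * (‖y‖ * dist ξ η) := by ring
          _ ≤ L * (2 * ‖x - y‖) := by gcongr
          _ = _ := by ring
      rw [div_mul_eq_mul_div]
      exact div_le_div₀ (by positivity) h5 (by positivity)
        (mul_le_mul (hmle ξ) (hmle η) hm.le hξ.le)
    calc _ ≤ ‖x - y‖ * (1 / m) + 2 * L / (m * m) * ‖x - y‖ := add_le_add h1 h2
      _ = K * ‖x - y‖ := by rw [hK]; ring

/-- The restriction to the unit sphere of a norm preserving homogeneous map. -/
def HomogBiLip.sphereHomeomorph (G : HomogBiLip (Euc d)) (hG : ∀ x, ‖G x‖ = ‖x‖) :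
    USphere d ≃ₜ USphere d where
  toFun ξ := ⟨G ξ, mem_sphere_zero_iff_norm.2 ((hG _).trans ξ.norm_eq)⟩
  invFun ξ := ⟨G.symm ξ, mem_sphere_zero_iff_norm.2
    ((hG _).symm.trans ((congrArg norm (G.apply_symm_apply _)).trans ξ.norm_eq))⟩
  left_inv _ := Subtype.ext (G.symm_apply_apply _)
  right_inv _ := Subtype.ext (G.apply_symm_apply _)
  continuous_toFun := (G.continuous.comp continuous_subtype_val).subtype_mk _
  continuous_invFun := (G.symm.continuous.comp continuous_subtype_val).subtype_mk _

theorem HomogBiLip.sphereHomeomorph_coe (G : HomogBiLip (Euc d)) (hG : ∀ x, ‖G x‖ = ‖x‖)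
    (ξ : USphere d) : (G.sphereHomeomorph hG ξ : Euc d) = G ξ := rfl

theorem HomogBiLip.sphereHomeomorph_lipschitz (G : HomogBiLip (Euc d))
    (hG : ∀ x, ‖G x‖ = ‖x‖) : ∃ L, LipschitzWith L (G.sphereHomeomorph hG) := by
  obtain ⟨K, hK⟩ := G.lipschitz
  exact ⟨K, fun ξ η => hK ξ η⟩

theorem HomogBiLip.sphereHomeomorph_symm_lipschitz (G : HomogBiLip (Euc d))
    (hG : ∀ x, ‖G x‖ = ‖x‖) : ∃ L, LipschitzWith L (G.sphereHomeomorph hG).symm := by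
  obtain ⟨K, hK⟩ := G.symm.lipschitz
  exact ⟨K, fun ξ η => hK ξ η⟩

theorem hasFDerivAt_norm_coe (ξ : USphere d) :
    HasFDerivAt (fun x : Euc d => ‖x‖) (innerSL ℝ (ξ : Euc d)) (ξ : Euc d) := by
  have h := ((hasStrictFDerivAt_norm_sq (ξ : Euc d)).hasFDerivAt).sqrt (by simp)
  have heq : (fun x : Euc d => √(‖x‖ ^ 2)) = fun x => ‖x‖ := by
    ext x
    exact Real.sqrt_sq (norm_nonneg x)
  rw [heq] at h
  refine h.congr_fderiv ?_
  ext z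
  simp

/-- The sphere Jacobian of the restriction of a norm preserving homogeneous map is the
determinant of its derivative. -/
theorem HomogBiLip.hasSphereJacobianAt (G : HomogBiLip (Euc d)) (hG : ∀ x, ‖G x‖ = ‖x‖)
    {ξ : USphere d} {D : Euc d →L[ℝ] Euc d} (hD : HasFDerivAt G D (ξ : Euc d)) :
    HasSphereJacobianAt (G.sphereHomeomorph hG) ξ D.det := by
  have hinv : HasFDerivAt (fun x : Euc d => ‖x‖⁻¹) (-innerSL ℝ (ξ : Euc d)) (ξ : Euc d) := by
    have := (hasDerivAt_inv (x := ‖(ξ : Euc d)‖) (by simp)).comp_hasFDerivAt (ξ : Euc d)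
      (hasFDerivAt_norm_coe ξ)
    refine this.congr_fderiv ?_
    simp
  have hext : homogeneousExtension (G.sphereHomeomorph hG) =ᶠ[𝓝 (ξ : Euc d)]
      fun x => ‖x‖⁻¹ • G x := by
    filter_upwards [isOpen_ne.mem_nhds ξ.ne_zero] with x hx
    rw [homogeneousExtension, dif_neg hx, G.sphereHomeomorph_coe]
    exact G.map_smul (inv_nonneg.2 (norm_nonneg x)) x
  -- The extension is ‖x‖⁻¹ G x near ξ, with derivative D - (G ξ) ξᵀ; adding (H ξ) ξᵀ in the
  -- definition of the Jacobian restores D.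
  refine ⟨D + (-innerSL ℝ (ξ : Euc d)).smulRight (G ξ), ?_, ?_⟩
  · refine HasFDerivAt.congr_of_eventuallyEq ?_ hext
    refine (hinv.smul hD).congr_fderiv ?_
    simp
  · congr 1
    rw [G.sphereHomeomorph_coe]
    ext z
    simp

/-- A degree-one map has the same derivative all along a ray, so differentiability at one point of
the ray reaches the sphere. -/
theorem HomogBiLip.hasFDerivAt_of_smul (G : HomogBiLip (Euc d)) {x : Euc d} {r : ℝ} (hr : 0 < r)
    {D : Euc d →L[ℝ] Euc d} (hD : HasFDerivAt G D (r • x)) : HasFDerivAt G D x := by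
  have h1 : HasFDerivAt (fun z : Euc d => r • z) (r • ContinuousLinearMap.id ℝ (Euc d)) x :=
    (hasFDerivAt_id x).const_smul r
  have h2 := (hD.comp x h1).const_smul r⁻¹
  have heq : (r⁻¹ • (G ∘ fun z : Euc d => r • z)) = G := by
    ext1 z
    simp only [Pi.smul_apply, Function.comp_apply]
    rw [G.map_smul hr.le, smul_smul, inv_mul_cancel₀ hr.ne', one_smul]
  rw [heq] at h2
  refine h2.congr_fderiv ?_
  ext z
  simp [smul_smul, hr.ne']

/-- A property that holds almost everywhere in space holds, for almost every direction, somewhere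
on the ray in this direction. -/
theorem ae_surfaceMeasure_of_ae {p : Euc d → Prop} (hp : ∀ᵐ x, p x) :
    ∀ᵐ ξ : USphere d ∂(surfaceMeasure d), ∃ r : ℝ, 0 < r ∧ p (r • (ξ : Euc d)) := by
  have h1 : ∀ᵐ z : ({0}ᶜ : Set (Euc d)) ∂((volume : Measure (Euc d)).comap ((↑) : ({0}ᶜ : Set (Euc d)) → Euc d)),
      p z := by
    refine ae_of_ae_map measurable_subtype_coe.aemeasurable ?_
    rw [map_comap_subtype_coe (measurableSet_singleton _).compl]
    exact ae_restrict_of_ae hp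
  have hmp := (volume : Measure (Euc d)).measurePreserving_homeomorphUnitSphereProd
  have hmp' := hmp.symm (homeomorphUnitSphereProd (Euc d)).toMeasurableEquiv
  have h2 := Measure.ae_ae_of_ae_prod (hmp'.quasiMeasurePreserving.ae h1)
  -- The radial measure is nonzero, so a property holding for almost every r holds for some r.
  have hne : NeBot (ae (Measure.volumeIoiPow (Module.finrank ℝ (Euc d) - 1))) := by
    rw [ae_neBot]
    intro h0
    have := Measure.volumeIoiPow_apply_Iio (Module.finrank ℝ (Euc d) - 1) ⟨1, mem_Ioi.2 one_pos⟩
    rw [h0] at this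
    simp only [Measure.coe_zero, Pi.zero_apply, one_pow] at this
    have := ENNReal.ofReal_eq_zero.1 this.symm
    have h3 : (0 : ℝ) < 1 / ((Module.finrank ℝ (Euc d) - 1 : ℕ) + 1) := by positivity
    linarith
  filter_upwards [h2] with ξ hξ
  obtain ⟨r, hr⟩ := hξ.exists
  exact ⟨r, r.2, hr⟩

theorem cone_image_sphereHomeomorph (G : HomogBiLip (Euc d)) (hG : ∀ x, ‖G x‖ = ‖x‖)
    (A : Set (USphere d)) :
    Ioo (0 : ℝ) 1 • ((↑) '' (G.sphereHomeomorph hG '' A) : Set (Euc d)) =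
      G '' (Ioo (0 : ℝ) 1 • ((↑) '' A : Set (Euc d))) := by
  ext x
  constructor
  · rintro ⟨r, hr, _, ⟨_, ⟨ξ, hξ, rfl⟩, rfl⟩, rfl⟩
    exact ⟨r • (ξ : Euc d), ⟨r, hr, ξ, ⟨ξ, hξ, rfl⟩, rfl⟩, G.map_smul hr.1.le _⟩
  · rintro ⟨_, ⟨r, hr, _, ⟨ξ, hξ, rfl⟩, rfl⟩, rfl⟩
    exact ⟨r, hr, _, ⟨_, ⟨ξ, hξ, rfl⟩, rfl⟩, (G.map_smul hr.1.le _).symm⟩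

theorem cone_eq_image (A : Set (USphere d)) : Ioo (0 : ℝ) 1 • ((↑) '' A : Set (Euc d)) =
    ((↑) : ({0}ᶜ : Set (Euc d)) → Euc d) ''
      (homeomorphUnitSphereProd (Euc d) ⁻¹' (A ×ˢ Iio ⟨1, mem_Ioi.2 one_pos⟩)) := by
  rw [← Homeomorph.image_symm]
  ext x
  constructor
  · rintro ⟨r, hr, _, ⟨ξ, hξ, rfl⟩, rfl⟩
    exact ⟨_, ⟨(ξ, ⟨r, hr.1⟩), ⟨hξ, hr.2⟩, rfl⟩, rfl⟩
  · rintro ⟨_, ⟨⟨ξ, r⟩, ⟨hξ, hr⟩, rfl⟩, rfl⟩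
    exact ⟨r, ⟨r.2, hr⟩, ξ, ⟨ξ, hξ, rfl⟩, rfl⟩

theorem measurableSet_cone {A : Set (USphere d)} (hA : MeasurableSet A) :
    MeasurableSet (Ioo (0 : ℝ) 1 • ((↑) '' A : Set (Euc d))) := by
  rw [cone_eq_image]
  exact (MeasurableEmbedding.subtype_coe (measurableSet_singleton _).compl).measurableSet_image.2
    ((homeomorphUnitSphereProd (Euc d)).measurable (hA.prod measurableSet_Iio))

/-- Integration over a cone of a function of degree zero. -/
theorem finrank_mul_lintegral_cone (hd : d ≠ 0) {A : Set (USphere d)} (hA : MeasurableSet A)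
    {f : USphere d → ℝ≥0∞} (hf : Measurable f) {g : Euc d → ℝ≥0∞}
    (hfg : ∀ (ξ : USphere d) (r : ℝ), 0 < r → g (r • (ξ : Euc d)) = f ξ) :
    (Module.finrank ℝ (Euc d) : ℝ≥0∞) * ∫⁻ x in Ioo (0 : ℝ) 1 • ((↑) '' A : Set (Euc d)), g x =
      ∫⁻ ξ in A, f ξ ∂(surfaceMeasure d) := by
  have hmp := (volume : Measure (Euc d)).measurePreserving_homeomorphUnitSphereProd
  set Φ := homeomorphUnitSphereProd (Euc d) with hΦ
  set I : Set (Ioi (0 : ℝ)) := Iio ⟨1, mem_Ioi.2 one_pos⟩ with hIdef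
  have hgΦ : ∀ z : ({0}ᶜ : Set (Euc d)), g z = f (Φ z).1 := fun z => by
    have hz : (z : Euc d) = ((Φ z).2 : ℝ) • ((Φ z).1 : Euc d) := by
      conv_lhs => rw [← Φ.symm_apply_apply z]
      rfl
    rw [hz, hfg _ _ (Φ z).2.2]
  have hdim : Module.finrank ℝ (Euc d) = d := by simp
  -- The radial mass is ∫₀¹ r^(d-1) dr = 1/d, which cancels the dimension factor in the surface
  -- measure.
  have hI : Measure.volumeIoiPow (Module.finrank ℝ (Euc d) - 1) I =
      (Module.finrank ℝ (Euc d) : ℝ≥0∞)⁻¹ := by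
    rw [Measure.volumeIoiPow_apply_Iio, hdim]
    have : ((d - 1 : ℕ) : ℝ) + 1 = d := by
      rw [← Nat.cast_add_one, Nat.sub_add_cancel (Nat.pos_of_ne_zero hd)]
    rw [this, one_pow, one_div, ENNReal.ofReal_inv_of_pos (by positivity), ENNReal.ofReal_natCast]
  rw [cone_eq_image, ← hIdef, ← hΦ, ← setLIntegral_subtype (measurableSet_singleton _).compl]
  simp only [hgΦ]
  rw [hmp.setLIntegral_comp_preimage (hA.prod (measurableSet_Iio : MeasurableSet I))
    (f := fun p => f p.1) (hf.comp measurable_fst), ← Measure.prod_restrict,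
    lintegral_prod (fun p => f p.1) (hf.comp measurable_fst).aemeasurable]
  simp only [lintegral_const, Measure.restrict_apply_univ]
  rw [lintegral_mul_const _ hf, hI, mul_comm, mul_assoc, ENNReal.inv_mul_cancel, mul_one]
  · rw [hdim]; exact_mod_cast hd
  · exact ENNReal.natCast_ne_top _

end Sphere

end

/-! ### Assembly of the theorem -/

theorem lemma2p1 (d : ℕ) (hd : 2 ≤ d) (R : USphere d → ℝ) (hRpos : ∀ ξ, 0 < R ξ)
    (hRlip : ∃ L, LipschitzWith L R) :
    ∃ H : USphere d ≃ₜ USphere d,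
      (∃ L, LipschitzWith L H) ∧ (∃ L, LipschitzWith L H.symm) ∧
      (∀ᵐ ξ ∂(surfaceMeasure d), HasSphereJacobianAt H ξ (volumeRatio R * R ξ ^ d)) ∧
      (∀ A : Set (USphere d), MeasurableSet A →
        surfaceMeasure d (H '' A) =
          ∫⁻ ξ in A, ENNReal.ofReal (volumeRatio R * R ξ ^ d) ∂(surfaceMeasure d)) ∧
      ∃ T : OpenPartialHomeomorph (Euc d) (Euc d),
        T.source = starlikeDomain R ∧ T.target = ball 0 1 ∧
        (∀ (ξ : USphere d) (r : ℝ), 0 ≤ r → r < R ξ →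
          T (r • (ξ : Euc d)) = (r / R ξ) • (H ξ : Euc d)) ∧
        (∃ L, LipschitzOnWith L T (starlikeDomain R)) ∧
        (∃ L, LipschitzOnWith L T.symm (ball 0 1)) ∧
        (∀ᵐ x ∂(volume.restrict (starlikeDomain R)), HasJacobianAt T x (volumeRatio R)) ∧
        (∀ᵐ y ∂(volume.restrict (ball (0 : Euc d) 1)),
          HasJacobianAt T.symm y (volumeRatio R)⁻¹) := by
  have : Nonempty (Fin d) := ⟨⟨0, by omega⟩⟩
  have hρ := isGauge_starGauge hRpos hRlip
  have hRmeas : Measurable R := hRlip.choose_spec.continuous.measurable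
  obtain ⟨T, (hT : ∀ x, ‖T x‖ = starGauge R x), k, hk, hdet⟩ := allGaugesEquiv_euc hd _ _ hρ IsGauge.norm
  set Ω := starlikeDomain R
  have hΩ : ∀ x, x ∈ Ω ↔ starGauge R x < 1 := fun x => mem_starlikeDomain_iff hRpos hd
  have hΩopen : IsOpen Ω := by
    have : Ω = {x | starGauge R x < 1} := Set.ext hΩ
    rw [this]
    exact isOpen_lt hρ.continuous continuous_const
  have himage : T '' Ω = ball 0 1 := by
    ext y
    rw [mem_ball_zero_iff]
    constructor
    · rintro ⟨x, hx, rfl⟩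
      rw [hT]
      exact (hΩ x).1 hx
    · intro hy
      refine ⟨T.symm y, (hΩ _).2 ?_, T.apply_symm_apply y⟩
      rw [← hT, T.apply_symm_apply]
      exact hy
  -- The area formula gives V(𝔹) = k V(Ω); Ω is open and nonempty, and bounded because c ‖x‖ ≤ ρ x <
  -- 1.
  have hratio : volumeRatio R = k := by
    have hvol := T.volume_image hdet hΩopen.measurableSet
    rw [himage, setLIntegral_const, abs_of_pos hk] at hvol
    obtain ⟨c, hc, hcle⟩ := hρ.exists_ge
    have hfin : volume Ω ≠ ⊤ := by
      refine ((measure_mono (fun x hx => ?_)).trans_lt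
        (measure_ball_lt_top (x := (0 : Euc d)) (r := 1 / c))).ne
      rw [mem_ball_zero_iff, lt_div_iff₀ hc, mul_comm]
      exact (hcle x).trans_lt ((hΩ x).1 hx)
    have hpos : volume Ω ≠ 0 :=
      (hΩopen.measure_pos volume ⟨0, (hΩ 0).2 (by rw [hρ.map_zero]; exact one_pos)⟩).ne'
    rw [volumeRatio, Measure.real, Measure.real, hvol, ENNReal.toReal_mul,
      ENNReal.toReal_ofReal hk.le, mul_div_assoc, div_self, mul_one]
    exact (ENNReal.toReal_pos hpos hfin).ne'
  rw [hratio]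
  -- Rescaling the norm to ρ before applying T gives a norm-preserving map; its restriction to the
  -- sphere is H.
  set G := (HomogBiLip.radial IsGauge.norm hρ).trans T with hGdef
  have hG : ∀ x, ‖G x‖ = ‖x‖ := fun x => by
    by_cases hx : x = 0
    · rw [hx, G.map_zero]
    have h1 := hρ.pos x hx
    rw [hGdef, HomogBiLip.trans_apply, hT, HomogBiLip.radial_apply, hρ.smul _ (by positivity)]
    field_simp
  have hGξ : ∀ ξ : USphere d, G ξ = R ξ • T ξ := fun ξ => by
    rw [hGdef, HomogBiLip.trans_apply, HomogBiLip.radial_apply, starGauge_coe, ξ.norm_eq,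
      one_div_one_div, T.map_smul (hRpos ξ).le]
  have hGdet : HasDet G (fun x => k * (‖x‖ / starGauge R x) ^ d) := by
    have := HomogBiLip.hasDet_trans (HomogBiLip.hasDet_radial IsGauge.norm hρ) hdet
    rwa [finrank_euclideanSpace_fin] at this
  have hdeg : ∀ (ξ : USphere d) (r : ℝ), 0 < r →
      k * (‖r • (ξ : Euc d)‖ / starGauge R (r • (ξ : Euc d))) ^ d = k * R ξ ^ d := by
    intro ξ r hr
    have := hRpos ξ
    rw [starGauge_smul_coe R hr.le, norm_smul, ξ.norm_eq, Real.norm_of_nonneg hr.le]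
    field_simp
  refine ⟨G.sphereHomeomorph hG, G.sphereHomeomorph_lipschitz hG,
    G.sphereHomeomorph_symm_lipschitz hG, ?_, ?_, ?_⟩
  · filter_upwards [ae_surfaceMeasure_of_ae hGdet] with ξ ⟨r, hr, D, hD, hDdet⟩
    rw [hdeg ξ r hr] at hDdet
    rw [← hDdet]
    exact G.hasSphereJacobianAt hG (G.hasFDerivAt_of_smul hr hD)
  · intro A hA
    have hHA : MeasurableSet (G.sphereHomeomorph hG '' A) :=
      (G.sphereHomeomorph hG).measurableEmbedding.measurableSet_image.2 hA
    rw [surfaceMeasure, Measure.toSphere_apply' _ hHA, cone_image_sphereHomeomorph,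
      G.volume_image hGdet (measurableSet_cone hA)]
    refine finrank_mul_lintegral_cone (by omega) hA
      (ENNReal.measurable_ofReal.comp (by fun_prop)) fun ξ r hr => ?_
    have := hRpos ξ
    rw [hdeg ξ r hr, abs_of_pos (by positivity)]
    rfl
  · refine ⟨T.toHomeomorph.toOpenPartialHomeomorphOfImageEq Ω hΩopen (ball 0 1) himage,
      rfl, rfl, fun ξ r hr _ => ?_, ?_, ?_, ?_, ?_⟩
    · change T (r • (ξ : Euc d)) = (r / R ξ) • G ξ
      have := hRpos ξ
      rw [hGξ, smul_smul, T.map_smul hr, div_mul_cancel₀ _ this.ne']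
    · obtain ⟨K, hK⟩ := T.lipschitz
      exact ⟨K, hK.lipschitzOnWith⟩
    · obtain ⟨K, hK⟩ := T.symm.lipschitz
      exact ⟨K, hK.lipschitzOnWith⟩
    · refine ae_restrict_of_ae ?_
      filter_upwards [hdet] with x ⟨D, hD, hDk⟩
      exact ⟨hD.differentiableAt, (congrArg _ hD.fderiv).trans hDk⟩
    · refine ae_restrict_of_ae ?_
      filter_upwards [HomogBiLip.hasDet_symm hdet (ae_of_all _ fun _ => hk.ne')]
        with x ⟨D, hD, hDk⟩
      exact ⟨hD.differentiableAt, (congrArg _ hD.fderiv).trans hDk⟩
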